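/- Let $n,l,k$ be positive integers with $l/k<1/n$ and let $\beta\in\mathbb R$; throughout, $1/\Gamma$ is taken to be $0$ at the poles of $\Gamma$. For $x\in\mathbb R$ let $$F^{(n)}_{l/k,\beta}(-x)=\sum_{r=0}^\infty\frac{(-x)^r}{[\Gamma(\beta+\frac lk r)]^n}$$ be the Mittag-Leffler function of Le Roy type. Write $\Delta(r,\lambda)$ for the list $\frac{\lambda}{r},\frac{\lambda+1}{r},\dots,\frac{\lambda+r-1}{r}$, and for $y>0$ put $$m_{l/k,\beta}(n;y)=(2\pi)^{\frac{1-k}{2}-\frac{n(1-l)}{2}}\,\frac{k^{3/2}}{l^{\,n(\beta-1/2)}}\,\frac1y\;G^{k,0}_{nl,k}\!\left(\frac{l^{nl}y^k}{k^k}\;\middle|\;{\overbrace{\Delta(l,\beta),\dots,\Delta(l,\beta)}^{n\text{ times}}\atop \Delta(k,1)}\right),$$ where the Meijer function $G^{k,0}_{nl,k}$ with upper parameters $a_1,\dots,a_{nl}$ and lower parameters $b_1,\dots,b_k$ is given for $z>0$ by the Mellin–Barnes integral $$G^{k,0}_{nl,k}\!\left(z\;\middle|\;{(a_i)\atop(b_j)}\right)=\frac1{2\pi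 i}\int_{\operatorname{Re}s=c}z^{-s}\,\frac{\prod_{j=1}^{k}\Gamma(b_j+s)}{\prod_{i=1}^{nl}\Gamma(a_i+s)}\,ds$$ along a vertical line to the right of all poles of the $\Gamma(b_j+s)$. For the parameters above this integral converges absolutely on every such line, and its value does not depend on the line. Moreover: 1. For every $x\in\mathbb R$ the series for $F^{(n)}_{l/k,\beta}(-x)$ converges, the function $y\mapsto e^{-xy}m_{l/k,\beta}(n;y)$ is integrable on $(0,\infty)$, and $$F^{(n)}_{l/k,\beta}(-x)=\int_0^\infty e^{-xy}\,m_{l/k,\beta}(n;y)\,dy.$$ 2. The power series $\sum_{r\ge0}c_ry^r$ with $c_r=\dfrac{(-1)^r}{r!\,[\Gamma(\beta-\frac lk(1+r))]^n}$ has infinite radius of convergence, and $m_{l/k,\beta}(n;y)=\sum_{r\ge0}c_ry^r$ for every $y>0$. 3. There are constants $A,a$ (depending on $n,l,k,\beta$) such that $|m_{l/k,\beta}(n;y)|\le A\,e^{ay}$ for all $y>0$. -/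

import Mathlib

noncomputable section

/-- The Mittag-Leffler function of Le Roy type
`F_{α,β}^{(n)}(x) = ∑ x ^ r / Γ(β + α r) ^ n` at a real point.  At a pole of `Γ` Mathlib's
`Real.Gamma` is `0`, so the term vanishes there, in accordance with `1 / Γ = 0` at the poles. -/
def mittagLefflerLeRoy (n : ℕ) (α β x : ℝ) : ℝ :=
  ∑' r : ℕ, x ^ r / Real.Gamma (β + α * r) ^ n

/-- The list `Δ(r, t) = [t / r, (t + 1) / r, …, (t + r - 1) / r]`. -/
def gammaList (r : ℕ) (t : ℂ) : List ℂ :=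
  (List.range r).map fun i => (t + i) / r

/-- The Mellin-Barnes kernel of `G^{m,n}_{p,q}` with upper parameters `a` (of length `p`) and lower
parameters `b` (of length `q`):
`∏_{j ≤ m} Γ(b_j + s) ∏_{i ≤ n} Γ(1 - a_i - s) / (∏_{i > n} Γ(a_i + s) ∏_{j > m} Γ(1 - b_j - s))`.
As `Complex.Gamma` is `0` at its poles, a pole in the denominator gives the value `0`. -/
def meijerKernel (m n : ℕ) (a b : List ℂ) (s : ℂ) : ℂ :=
  (((b.take m).map fun t => Complex.Gamma (t + s)).prod *
      ((a.take n).map fun t => Complex.Gamma (1 - t - s)).prod) /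
    (((a.drop n).map fun t => Complex.Gamma (t + s)).prod *
      ((b.drop m).map fun t => Complex.Gamma (1 - t - s)).prod)

/-- The vertical line `Re s = c` has all the poles of `Γ(b_j + s)`, `j ≤ m`, on its left and all the
poles of `Γ(1 - a_i - s)`, `i ≤ n`, on its right. -/
def SeparatesPoles (m n : ℕ) (a b : List ℂ) (c : ℝ) : Prop :=
  (∀ t ∈ b.take m, -t.re < c) ∧ ∀ t ∈ a.take n, c < 1 - t.re

/-- The Meijer function `G^{m,n}_{p,q}(z | a ; b)` at a real argument `z > 0`, as the Mellin-Barnes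
integral `(2πi)⁻¹ ∫ z ^ (-s) * meijerKernel m n a b s ds` along a vertical line that separates the
poles.  This is the standard contour when such a line exists and the integral converges absolutely
on it (always the case for `n = 0`, `p < m = q`); the value does not depend on the line. -/
def meijerG (m n : ℕ) (a b : List ℂ) (z : ℝ) : ℂ :=
  mellinInv (Classical.epsilon fun c : ℝ => SeparatesPoles m n a b c) (meijerKernel m n a b) z

/-- The upper parameters of the weight: `Δ(l, β)` repeated `n` times. -/
def upperParams (n l : ℕ) (β : ℝ) : List ℂ :=
  (List.replicate n (gammaList l (β : ℂ))).flatten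

/-- The lower parameters of the weight: `Δ(k, 1)`. -/
def lowerParams (k : ℕ) : List ℂ := gammaList k 1

/-- The weight function
`m_{l/k,β}(n; y) = (2π)^{(1-k)/2 - n(1-l)/2} k^{3/2} l^{-n(β-1/2)} y⁻¹
  G^{k,0}_{nl,k}(l^{nl} y^k / k^k | Δ(l,β), …, Δ(l,β) ; Δ(k,1))`, for `y > 0`. -/
def leRoyWeight (n l k : ℕ) (β y : ℝ) : ℂ :=
  (((2 * Real.pi) ^ ((1 - (k : ℝ)) / 2 - (n : ℝ) * (1 - (l : ℝ)) / 2) * (k : ℝ) ^ (3 / 2 : ℝ) *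
      (l : ℝ) ^ (-((n : ℝ) * (β - 1 / 2))) * y⁻¹ : ℝ) : ℂ) *
    meijerG k 0 (upperParams n l β) (lowerParams k) ((l : ℝ) ^ (n * l) * y ^ k / (k : ℝ) ^ k)

/-- The coefficients `c_r = (-1)^r / (r! Γ(β - (l/k)(1 + r))^n)`, with `1 / Γ = 0` at the poles. -/
def leRoyCoeff (n l k : ℕ) (β : ℝ) (r : ℕ) : ℝ :=
  (-1) ^ r / ((r.factorial : ℝ) * Real.Gamma (β - (l : ℝ) / k * (1 + r)) ^ n)

end

/-! Put α = l/k, b = β - α and M(s) = Γ(s)/Γ(b + αs)^n. Gauss's multiplication formula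
(`prod_Gamma_add_div`) collapses the k lower Gamma factors of the Meijer kernel to Γ(ks + 1) and
each block of l upper ones to Γ(ls + β). After the substitution w = ks + 1 the weight is therefore
the inverse Mellin transform of M (`leRoyWeight_eq_leRoyDensity`).

On vertical lines Γ(s) decays at rate π/2 while the denominator gives back only nαπ/2, so nα < 1
makes M decay exponentially. This yields absolute convergence and, by Cauchy's theorem, independence
of the line.

Moving the line to the left past the poles 0, -1, -2, ... produces the residues c_r y^r. The
remainder on Re s = 1/2 - N is a geometric factor times Γ(αN + const)^n / Γ(N + 1/2), which tends to
0 because nα < 1 (`hasSum_mellinInv_leRoyMellin`).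

Moving the line to the right, to Re s = N, bounds y^N |m(y)| by N!/Γ(b + αN)^n times a geometric
factor. Summing against X^N/N! gives |m(y)| ≤ C e^(-Xy) for every X ≥ 0
(`exists_norm_leRoyDensity_le`). Mellin inversion at s = r + 1 evaluates the moments as r!/Γ(β +
αr)^n, and integrating the exponential series term by term gives the Laplace representation
(`integrableOn_and_integral_exp_mul_leRoyDensity`). -/

section

/-! ### Inequalities for the real Gamma function and the two basic convergent series. -/

namespace Real

/-- Log-convexity on [1, 1 + u + w] together with Γ(1) = 1 bounds each factor by a power of Γ(1 + u
+ w), and the two exponents add up to 1. -/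
lemma Gamma_one_add_mul_Gamma_one_add_le {u w : ℝ} (hu : 0 ≤ u) (hw : 0 ≤ w) :
    Gamma (1 + u) * Gamma (1 + w) ≤ Gamma (1 + u + w) := by
  rcases hu.eq_or_lt with rfl | hu
  · simp
  rcases hw.eq_or_lt with rfl | hw
  · simp
  have hG : 0 < Gamma (1 + u + w) := Gamma_pos_of_pos (by positivity)
  have hs : 0 < u + w := by positivity
  have key : ∀ p q : ℝ, 0 < p → 0 < q → p + q = u + w →
      Gamma (1 + p) ≤ Gamma (1 + u + w) ^ (p / (u + w)) := by
    intro p q hp hq hpq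
    have := Gamma_mul_add_mul_le_rpow_Gamma_mul_rpow_Gamma (s := 1 + u + w) (t := 1)
      (a := p / (u + w)) (b := q / (u + w)) (by positivity) one_pos (by positivity)
      (by positivity) (by rw [← add_div, hpq, div_self hs.ne'])
    rw [Gamma_one, one_rpow, mul_one, mul_one] at this
    refine le_trans (le_of_eq ?_) this
    congr 1
    field_simp
    linear_combination -hpq
  calc Gamma (1 + u) * Gamma (1 + w)
      ≤ Gamma (1 + u + w) ^ (u / (u + w)) * Gamma (1 + u + w) ^ (w / (u + w)) := by
        have := (Gamma_pos_of_pos (show 0 < 1 + w by positivity)).le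
        gcongr
        · exact key u w hu hw rfl
        · exact key w u hw hu (add_comm _ _)
    _ = Gamma (1 + u + w) := by
        rw [← rpow_add hG, ← add_div, div_self hs.ne', rpow_one]

lemma Gamma_one_add_pow_le {u : ℝ} (hu : 0 ≤ u) (n : ℕ) :
    Gamma (1 + u) ^ n ≤ Gamma (1 + n * u) := by
  induction n with
  | zero => simp
  | succ n ih =>
    have h1 : 0 ≤ Gamma (1 + u) := (Gamma_pos_of_pos (by positivity)).le
    calc Gamma (1 + u) ^ (n + 1) ≤ Gamma (1 + n * u) * Gamma (1 + u) := by
          rw [pow_succ]; gcongr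
      _ ≤ Gamma (1 + n * u + u) := Gamma_one_add_mul_Gamma_one_add_le (by positivity) hu
      _ = _ := by push_cast; ring_nf

/-- Only the part of Euler's integral over (D, D + 1] is kept. As D is free, Γ outgrows every
geometric sequence. -/
lemma rpow_mul_exp_neg_le_Gamma {D x : ℝ} (hD : 0 < D) (hx : 1 ≤ x) :
    D ^ (x - 1) * exp (-(D + 1)) ≤ Gamma x := by
  rw [Gamma_eq_integral (by linarith)]
  have hint := GammaIntegral_convergent (s := x) (by linarith)
  have hsub : Set.Ioc D (D + 1) ⊆ Set.Ioi 0 := fun t ht => hD.trans ht.1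
  calc D ^ (x - 1) * exp (-(D + 1))
      = ∫ _ in Set.Ioc D (D + 1), D ^ (x - 1) * exp (-(D + 1)) := by simp
    _ ≤ ∫ t in Set.Ioc D (D + 1), exp (-t) * t ^ (x - 1) := by
        refine MeasureTheory.setIntegral_mono_on
          (MeasureTheory.integrableOn_const (by simp)) (hint.mono_set hsub) measurableSet_Ioc fun t ht => ?_
        rw [mul_comm]
        have := ht.1.le
        gcongr
        exact ht.2
    _ ≤ _ := by
        refine MeasureTheory.setIntegral_mono_set hint ?_ hsub.eventuallyLE
        filter_upwards [MeasureTheory.ae_restrict_mem measurableSet_Ioi] with t ht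
        have : (0 : ℝ) < t := ht
        simp only [Pi.zero_apply]
        positivity

lemma eventually_one_le_add_mul {α : ℝ} (hα : 0 < α) (β : ℝ) :
    ∀ᶠ r : ℕ in Filter.atTop, 1 ≤ β + α * r :=
  (Filter.tendsto_atTop_add_const_left _ β
    (tendsto_natCast_atTop_atTop.const_mul_atTop hα)).eventually_ge_atTop 1

/-- The series of the Mittag-Leffler function of Le Roy type converges everywhere. -/
lemma summable_pow_div_Gamma_pow {n : ℕ} (hn : 0 < n) {α : ℝ} (hα : 0 < α) (β D : ℝ) :
    Summable fun r : ℕ => D ^ r / Gamma (β + α * r) ^ n := by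
  set A : ℝ := 2 * |D| + 1 with hA
  have hA0 : 0 < A := by positivity
  -- E is chosen so that Γ(β + αr)^n grows at least like A^r, and A > |D| then gives a geometric
  -- majorant.
  set E : ℝ := A ^ (α * n)⁻¹ with hE
  have hE0 : 0 < E := by positivity
  have hEA : (E ^ α) ^ n = A := by
    rw [← rpow_natCast, ← rpow_mul hE0.le, hE, ← rpow_mul hA0.le, inv_mul_cancel₀ (by positivity),
      rpow_one]
  set c : ℝ := E ^ (β - 1) * exp (-(E + 1)) with hc
  have hc0 : 0 < c := by positivity
  have hDA : |D| / A < 1 := by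
    rw [div_lt_one hA0]; have := abs_nonneg D; linarith
  refine Summable.of_norm_bounded_eventually_nat (g := fun r : ℕ => (c ^ n)⁻¹ * (|D| / A) ^ r)
    ((summable_geometric_of_lt_one (by positivity) hDA).mul_left _) ?_
  filter_upwards [eventually_one_le_add_mul hα β] with r hr
  have h1 : c * (E ^ α) ^ r ≤ Gamma (β + α * r) := by
    refine le_trans (le_of_eq ?_) (rpow_mul_exp_neg_le_Gamma hE0 hr)
    rw [hc, ← rpow_natCast, ← rpow_mul hE0.le, mul_right_comm, ← rpow_add hE0]
    ring_nf
  have h2 : c ^ n * A ^ r ≤ Gamma (β + α * r) ^ n := by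
    calc c ^ n * A ^ r = (c * (E ^ α) ^ r) ^ n := by
          rw [mul_pow c, ← hEA, ← pow_mul, ← pow_mul, mul_comm n r]
      _ ≤ _ := by gcongr
  have hG : 0 < Gamma (β + α * r) := Gamma_pos_of_pos (by linarith)
  rw [norm_div, norm_pow, norm_pow, norm_eq_abs, norm_eq_abs, abs_of_pos hG, div_pow]
  calc |D| ^ r / Gamma (β + α * r) ^ n ≤ |D| ^ r / (c ^ n * A ^ r) := by gcongr
    _ = _ := by field_simp

/-- The product inequality turns the quotient into at most 1/Γ(const + (1 - nα)r), so the previous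
series applies. It serves both for the power series coefficients and for the remainder of the
contour shift. -/
lemma summable_Gamma_pow_mul_pow_div_Gamma {n : ℕ} {α : ℝ} (hα : 0 < α)
    (hnα : n * α < 1) (q p D : ℝ) :
    Summable fun r : ℕ => Gamma (q + α * r) ^ n * D ^ r / Gamma (p + r) := by
  have h1 : 0 < 1 - n * α := by linarith
  refine Summable.of_norm_bounded_eventually_nat
    (g := fun r : ℕ => |D| ^ r / Gamma ((p - n * (q - 1)) + (1 - n * α) * r) ^ 1)
    (summable_pow_div_Gamma_pow one_pos h1 _ _) ?_
  filter_upwards [eventually_one_le_add_mul hα q, eventually_one_le_add_mul h1 (p - n * (q - 1))]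
    with r hr1 hr2
  set u := q + α * r - 1 with hu
  set w := p - n * (q - 1) + (1 - n * α) * r - 1 with hw
  have hu0 : 0 ≤ u := by linarith
  have hw0 : 0 ≤ w := by linarith
  have e1 : q + α * r = 1 + u := by rw [hu]; ring
  have e2 : p - n * (q - 1) + (1 - n * α) * r = 1 + w := by rw [hw]; ring
  have e3 : p + r = 1 + n * u + w := by rw [hw, hu]; ring
  have hGu : 0 < Gamma (1 + u) := Gamma_pos_of_pos (by positivity)
  have hGw : 0 < Gamma (1 + w) := Gamma_pos_of_pos (by positivity)
  have hGs : 0 < Gamma (1 + n * u + w) := Gamma_pos_of_pos (by positivity)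
  rw [e1, e2, e3, norm_div, norm_mul, norm_pow, norm_pow, norm_eq_abs, norm_eq_abs, norm_eq_abs,
    abs_of_pos hGu, abs_of_pos hGs, pow_one, div_le_div_iff₀ hGs hGw]
  calc Gamma (1 + u) ^ n * |D| ^ r * Gamma (1 + w)
      ≤ Gamma (1 + n * u) * |D| ^ r * Gamma (1 + w) := by
        gcongr; exact Gamma_one_add_pow_le hu0 n
    _ = |D| ^ r * (Gamma (1 + n * u) * Gamma (1 + w)) := by ring
    _ ≤ |D| ^ r * Gamma (1 + n * u + w) := by
        gcongr; exact Gamma_one_add_mul_Gamma_one_add_le (by positivity) hw0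

end Real

end

/-! ### Integrals along vertical lines: Cauchy's theorem and the residue at a pole of π / sin(πs).
-/

section

open Filter Topology MeasureTheory Set

lemma integrable_exp_neg_mul_abs {δ : ℝ} (hδ : 0 < δ) :
    Integrable fun t : ℝ => Real.exp (-(δ * |t|)) := by
  have h : IntegrableOn (fun t : ℝ => Real.exp (-(δ * |t|))) (Ioi 0) := by
    refine IntegrableOn.congr_fun (f := fun t : ℝ => Real.exp (-δ * t))
      (exp_neg_integrableOn_Ioi 0 hδ) (fun t ht => ?_) measurableSet_Ioi
    simp [abs_of_pos (mem_Ioi.mp ht)]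
  have h' : IntegrableOn (fun t : ℝ => Real.exp (-(δ * |t|))) (Iic 0) := by
    refine IntegrableOn.congr_fun (f := fun t : ℝ => Real.exp (δ * t))
      (integrableOn_exp_mul_Iic hδ 0) (fun t ht => ?_) measurableSet_Iic
    simp [abs_of_nonpos (mem_Iic.mp ht)]
  rw [← integrableOn_univ, ← Iic_union_Ioi (a := (0 : ℝ))]
  exact h'.union h

lemma integrable_of_continuous_of_norm_le_exp {f : ℝ → ℂ} (hf : Continuous f) {C δ : ℝ}
    (hδ : 0 < δ) (h : ∀ t, 1 ≤ |t| → ‖f t‖ ≤ C * Real.exp (-(δ * |t|))) : Integrable f := by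
  obtain ⟨B, hB⟩ := (isCompact_Icc (a := (-1 : ℝ)) (b := 1)).exists_bound_of_continuousOn
    hf.continuousOn
  refine Integrable.mono' ((integrable_exp_neg_mul_abs hδ).const_mul (|C| + |B| * Real.exp δ))
    hf.aestronglyMeasurable (Eventually.of_forall fun t => ?_)
  rw [add_mul]
  rcases le_total 1 |t| with ht | ht
  · calc ‖f t‖ ≤ C * Real.exp (-(δ * |t|)) := h t ht
      _ ≤ |C| * Real.exp (-(δ * |t|)) := by gcongr; exact le_abs_self C
      _ ≤ _ := le_add_of_nonneg_right (by positivity)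
  · calc ‖f t‖ ≤ B := hB t (abs_le.mp ht)
      _ ≤ |B| * 1 := by rw [mul_one]; exact le_abs_self B
      _ ≤ |B| * (Real.exp δ * Real.exp (-(δ * |t|))) := by
          gcongr
          rw [← Real.exp_add, Real.one_le_exp_iff]
          nlinarith
      _ ≤ _ := by rw [mul_assoc]; exact le_add_of_nonneg_left (by positivity)

namespace Complex

lemma continuous_comp_vertical_line {φ : ℂ → ℂ} {S : Set ℂ} (hφ : ContinuousOn φ S) {σ : ℝ}
    (hσ : ∀ t : ℝ, (σ + t * I : ℂ) ∈ S) : Continuous fun t : ℝ => φ (σ + t * I) :=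
  hφ.comp_continuous (by fun_prop) hσ

/-- Shifting a vertical line of integration inside a strip of holomorphy. -/
lemma integral_vertical_eq {φ : ℂ → ℂ} {a b : ℝ} (hab : a ≤ b)
    (hφ : DifferentiableOn ℂ φ {s | s.re ∈ Icc a b}) {C δ : ℝ} (hδ : 0 < δ)
    (h : ∀ σ ∈ Icc a b, ∀ t : ℝ, 1 ≤ |t| → ‖φ (σ + t * I)‖ ≤ C * Real.exp (-(δ * |t|))) :
    ∫ t : ℝ, φ (a + t * I) = ∫ t : ℝ, φ (b + t * I) := by
  have hint : ∀ σ ∈ Icc a b, Integrable fun t : ℝ => φ (σ + t * I) := fun σ hσ =>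
    integrable_of_continuous_of_norm_le_exp
      (continuous_comp_vertical_line hφ.continuousOn (fun t => by simpa using hσ)) hδ (h σ hσ)
  have hlim : ∀ σ ∈ Icc a b, Tendsto (fun T : ℝ => ∫ t in (-T)..T, φ (σ + t * I)) atTop
      (𝓝 (∫ t : ℝ, φ (σ + t * I))) := fun σ hσ =>
    intervalIntegral_tendsto_integral (hint σ hσ) tendsto_neg_atTop_atBot tendsto_id
  have hzero : Tendsto (fun T : ℝ => (∫ t in (-T)..T, φ (b + t * I)) -
      ∫ t in (-T)..T, φ (a + t * I)) atTop (𝓝 0) := by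
    have hexp : Tendsto (fun T : ℝ => 2 * (C * Real.exp (-(δ * T)) * |b - a|)) atTop (𝓝 0) := by
      have : Tendsto (fun T : ℝ => Real.exp (-(δ * T))) atTop (𝓝 0) :=
        Real.tendsto_exp_neg_atTop_nhds_zero.comp (tendsto_id.const_mul_atTop hδ)
      simpa using ((this.const_mul C).mul_const |b - a|).const_mul 2
    refine squeeze_zero_norm' ?_ hexp
    filter_upwards [eventually_ge_atTop 1] with T hT
    have hT0 : |T| = T := abs_of_nonneg (by linarith)
    -- The two horizontal sides of the rectangle at heights ±T are O(e^(-δT)).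
    have hrect := integral_boundary_rect_eq_zero_of_differentiableOn φ (a + (-T : ℝ) * I)
      (b + T * I) (hφ.mono fun s hs => by
        have := hs.1
        simp only [add_re, ofReal_re, mul_re, ofReal_im, I_re, I_im, mul_zero, zero_mul, sub_zero,
          add_zero, mem_preimage, uIcc_of_le hab] at this
        exact this)
    simp only [add_re, ofReal_re, mul_re, ofReal_im, I_re, I_im, mul_zero, sub_zero,
      add_zero, add_im, mul_im, mul_one, zero_add, smul_eq_mul] at hrect
    have hor : ∀ τ : ℝ, |τ| = T →
        ‖∫ x in a..b, φ (x + τ * I)‖ ≤ C * Real.exp (-(δ * T)) * |b - a| := fun τ hτ =>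
      intervalIntegral.norm_integral_le_of_norm_le_const fun x hx => by
        rw [uIoc_of_le hab] at hx
        have := h x ⟨hx.1.le, hx.2⟩ τ (by rw [hτ]; exact hT)
        rwa [hτ] at this
    have h1 := hor (-T) (by rw [abs_neg, hT0])
    have h2 := hor T hT0
    have e : I * ((∫ t in (-T)..T, φ (b + t * I)) - ∫ t in (-T)..T, φ (a + t * I)) =
        (∫ x in a..b, φ (x + T * I)) - ∫ x in a..b, φ (x + (-T : ℝ) * I) := by
      linear_combination hrect
    calc _ = ‖I * ((∫ t in (-T)..T, φ (b + t * I)) - ∫ t in (-T)..T, φ (a + t * I))‖ := by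
          rw [norm_mul, norm_I, one_mul]
      _ ≤ _ := by
          rw [e]
          refine (norm_sub_le _ _).trans ?_
          linarith
  have hlim' := (hlim b ⟨hab, le_rfl⟩).sub (hlim a ⟨le_rfl, hab⟩)
  exact (sub_eq_zero.mp (tendsto_nhds_unique hlim' hzero)).symm

/-- On Re s = ±1/2 the kernel π / sin(πs) equals ±π / cosh(πt). This explicit integral, with
antiderivative 2 arctan(e^(πt)), supplies the residue at 0. -/
lemma integrable_and_integral_pi_div_cosh :
    Integrable (fun t : ℝ => Real.pi / Real.cosh (Real.pi * t)) ∧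
      ∫ t : ℝ, Real.pi / Real.cosh (Real.pi * t) = Real.pi := by
  have hpi := Real.pi_pos
  have hder : ∀ t : ℝ, HasDerivAt (fun t => 2 * Real.arctan (Real.exp (Real.pi * t)))
      (Real.pi / Real.cosh (Real.pi * t)) t := by
    intro t
    have h1 : HasDerivAt (fun t : ℝ => Real.exp (Real.pi * t))
        (Real.exp (Real.pi * t) * Real.pi) t := by
      simpa using ((hasDerivAt_id t).const_mul Real.pi).exp
    refine (h1.arctan.const_mul 2).congr_deriv ?_
    rw [Real.cosh_eq, Real.exp_neg]
    have := Real.exp_pos (Real.pi * t)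
    field_simp
    ring
  have hcosh : ∀ x : ℝ, Real.exp |x| / 2 ≤ Real.cosh x := by
    intro x
    rw [← Real.cosh_abs, Real.cosh_eq]
    have := Real.exp_pos (-|x|)
    linarith
  have hint : Integrable fun t : ℝ => Real.pi / Real.cosh (Real.pi * t) := by
    refine Integrable.mono' ((integrable_exp_neg_mul_abs hpi).const_mul (2 * Real.pi))
      (Continuous.aestronglyMeasurable ?_) (Eventually.of_forall fun t => ?_)
    · exact continuous_const.div (by fun_prop) fun t => (Real.cosh_pos _).ne'
    · have := hcosh (Real.pi * t)
      rw [abs_mul, abs_of_pos hpi] at this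
      rw [norm_div, Real.norm_eq_abs, Real.norm_eq_abs, abs_of_pos hpi,
        abs_of_pos (Real.cosh_pos _), Real.exp_neg]
      calc Real.pi / Real.cosh (Real.pi * t) ≤ Real.pi / (Real.exp (Real.pi * |t|) / 2) := by gcongr
        _ = _ := by field_simp
  have hbot : Tendsto (fun t => 2 * Real.arctan (Real.exp (Real.pi * t))) atBot (𝓝 0) := by
    have : Tendsto (fun t => Real.exp (Real.pi * t)) atBot (𝓝 0) :=
      Real.tendsto_exp_atBot.comp (tendsto_id.const_mul_atBot hpi)
    simpa using ((Real.continuous_arctan.tendsto 0).comp this).const_mul 2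
  have htop : Tendsto (fun t => 2 * Real.arctan (Real.exp (Real.pi * t))) atTop (𝓝 Real.pi) := by
    have : Tendsto (fun t => Real.exp (Real.pi * t)) atTop atTop :=
      Real.tendsto_exp_atTop.comp (tendsto_id.const_mul_atTop hpi)
    have := ((Real.tendsto_arctan_atTop.mono_right nhdsWithin_le_nhds).comp this).const_mul 2
    rwa [mul_div_cancel₀ _ (two_ne_zero)] at this
  refine ⟨hint, ?_⟩
  rw [integral_of_hasDerivAt_of_tendsto hder hint hbot htop, sub_zero]


lemma norm_sin_le_exp (z : ℂ) : ‖sin z‖ ≤ Real.exp |z.im| := by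
  have h1 : ‖cexp (-z * I)‖ ≤ Real.exp |z.im| := by
    rw [norm_exp]; simpa using le_abs_self z.im
  have h2 : ‖cexp (z * I)‖ ≤ Real.exp |z.im| := by
    rw [norm_exp]; simpa using neg_le_abs z.im
  rw [sin, norm_div, norm_mul, norm_I, mul_one, show ‖(2 : ℂ)‖ = 2 by norm_num, div_le_iff₀ two_pos]
  exact (norm_sub_le _ _).trans (by linarith)

lemma exp_abs_im_div_four_le_norm_sin {z : ℂ} (hz : 1 ≤ |z.im|) :
    Real.exp |z.im| / 4 ≤ ‖sin z‖ := by
  have h1 : ‖cexp (-z * I)‖ = Real.exp z.im := by rw [norm_exp]; simp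
  have h2 : ‖cexp (z * I)‖ = Real.exp (-z.im) := by rw [norm_exp]; simp
  have h3 : |Real.exp z.im - Real.exp (-z.im)| / 2 ≤ ‖sin z‖ := by
    rw [sin, norm_div, norm_mul, norm_I, mul_one, show ‖(2 : ℂ)‖ = 2 by norm_num, ← h1, ← h2]
    gcongr
    exact abs_norm_sub_norm_le _ _
  have h4 : 2 ≤ Real.exp |z.im| := by
    have := Real.add_one_le_exp |z.im|
    linarith
  have h5 : Real.exp (-|z.im|) ≤ 1 := Real.exp_le_one_iff.mpr (by linarith)
  refine le_trans ?_ h3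
  rcases abs_cases z.im with ⟨h, -⟩ | ⟨h, -⟩ <;> rw [h] at h4 h5 ⊢
  · have := le_abs_self (Real.exp z.im - Real.exp (-z.im)); linarith
  · have := neg_le_abs (Real.exp z.im - Real.exp (-z.im))
    rw [neg_neg] at h5; linarith

lemma norm_pi_div_sin_le {s : ℂ} (hs : 1 ≤ |s.im|) :
    ‖Real.pi / sin (Real.pi * s)‖ ≤ 4 * Real.pi * Real.exp (-(Real.pi * |s.im|)) := by
  have hpi := Real.pi_pos
  have him : |((Real.pi : ℂ) * s).im| = Real.pi * |s.im| := by
    simp [abs_mul, abs_of_pos hpi]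
  have h := exp_abs_im_div_four_le_norm_sin (z := Real.pi * s) (by
    rw [him]; nlinarith [Real.pi_gt_three])
  rw [him] at h
  rw [norm_div, norm_real, Real.norm_eq_abs, abs_of_pos hpi, Real.exp_neg]
  calc _ ≤ Real.pi / (Real.exp (Real.pi * |s.im|) / 4) := by gcongr
    _ = _ := by field_simp

lemma sin_pi_mul_half_add (t : ℝ) :
    sin (Real.pi * ((1 / 2 : ℝ) + t * I)) = Real.cosh (Real.pi * t) := by
  rw [mul_add, ← mul_assoc, sin_add_mul_I]
  have : (Real.pi : ℂ) * (1 / 2 : ℝ) = Real.pi / 2 := by push_cast; ring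
  rw [this, sin_pi_div_two, cos_pi_div_two]
  push_cast
  ring

lemma sin_pi_mul_neg_half_add (t : ℝ) :
    sin (Real.pi * ((-(1 / 2) : ℝ) + t * I)) = -Real.cosh (Real.pi * t) := by
  rw [← Real.cosh_neg, ← mul_neg, ← sin_pi_mul_half_add, ← sin_neg]
  congr 1
  push_cast
  ring

/-- The residue theorem on the strip `|Re s| ≤ 1 / 2` for `g s * (π / sin (π s))`. -/
lemma integral_vertical_sub_of_sin_pole {g : ℂ → ℂ} (hg : Differentiable ℂ g) {C δ : ℝ}
    (hδ : 0 < δ) (hδ' : δ ≤ Real.pi)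
    (h : ∀ σ ∈ Icc (-(1 / 2) : ℝ) (1 / 2), ∀ t : ℝ, 1 ≤ |t| →
      ‖g (σ + t * I)‖ ≤ C * Real.exp ((Real.pi - δ) * |t|)) :
    (∫ t : ℝ, g ((1 / 2 : ℝ) + t * I) * (Real.pi / sin (Real.pi * ((1 / 2 : ℝ) + t * I)))) -
      ∫ t : ℝ, g ((-(1 / 2) : ℝ) + t * I) *
        (Real.pi / sin (Real.pi * ((-(1 / 2) : ℝ) + t * I))) = 2 * Real.pi * g 0 := by
  have hpi := Real.pi_pos
  set S : ℂ → ℂ := fun s => sin (Real.pi * s) with hS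
  have hSd : Differentiable ℂ S := by fun_prop
  set k : ℂ → ℂ := fun s => Real.pi / sin (Real.pi * s) with hk
  -- q is (g(s) - g(0)) π / sin(πs) with the singularity at 0 removed. It can be shifted from one
  -- line to the other, which leaves g(0) times the explicit integrals of the kernel.
  set q : ℂ → ℂ := fun s => Real.pi * dslope g 0 s / dslope S 0 s with hq
  have hS0 : S 0 = 0 := by simp [hS]
  have hSder : deriv S 0 = Real.pi := by
    have : HasDerivAt S (cos (Real.pi * 0) * (Real.pi * 1)) 0 :=
      ((hasDerivAt_id (0 : ℂ)).const_mul (Real.pi : ℂ)).csin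
    simpa using this.deriv
  have hqne : ∀ s : ℂ, s ≠ 0 → q s = g s * k s - g 0 * k s := by
    intro s hs
    simp only [hq, hk]
    rw [dslope_of_ne _ hs, dslope_of_ne _ hs, slope_def_field, slope_def_field, hS0, sub_zero,
      sub_zero]
    rw [← sub_mul]
    by_cases h0 : sin (Real.pi * s) = 0
    · simp [hS, h0]
    · simp only [hS]; field_simp
  have hdiff : ∀ {f : ℂ → ℂ}, Differentiable ℂ f → Differentiable ℂ (dslope f 0) := fun hf =>
    differentiableOn_univ.mp
      ((differentiableOn_dslope (by simp)).mpr hf.differentiableOn)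
  have hqd : DifferentiableOn ℂ q {s | s.re ∈ Icc (-(1 / 2) : ℝ) (1 / 2)} := by
    refine DifferentiableOn.div ((hdiff hg).const_mul _).differentiableOn
      (hdiff hSd).differentiableOn fun s hs => ?_
    rcases eq_or_ne s 0 with rfl | hs0
    · rw [dslope_same, hSder]; exact ofReal_ne_zero.mpr hpi.ne'
    · rw [dslope_of_ne _ hs0, slope_def_field, hS0, sub_zero, sub_zero]
      refine div_ne_zero ?_ hs0
      -- The zeros of sin(πs) are the integers, and 0 is the only one in the strip.
      simp only [hS]
      rw [Ne, sin_eq_zero_iff]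
      rintro ⟨m, hm⟩
      rw [mul_comm] at hm
      have hsm := mul_right_cancel₀ (ofReal_ne_zero.mpr hpi.ne') hm
      rw [hsm] at hs hs0
      simp only [mem_ofPred_eq, intCast_re, mem_Icc] at hs
      have h1 : (-1 : ℝ) < m := by linarith [hs.1]
      have h2 : (m : ℝ) < 1 := by linarith [hs.2]
      have h1' : -1 < m := by exact_mod_cast h1
      have h2' : m < 1 := by exact_mod_cast h2
      exact hs0 (by rw [show m = 0 by omega]; simp)
  have hgk : ∀ σ ∈ Icc (-(1 / 2) : ℝ) (1 / 2), ∀ t : ℝ, 1 ≤ |t| →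
      ‖g (σ + t * I) * k (σ + t * I)‖ ≤ C * (4 * Real.pi) * Real.exp (-(δ * |t|)) := by
    intro σ hσ t ht
    have h1 := h σ hσ t ht
    have h2 := norm_pi_div_sin_le (s := σ + t * I) (by simpa using ht)
    have h3 : (σ + t * I : ℂ).im = t := by simp
    rw [h3] at h2
    calc ‖g (σ + t * I) * k (σ + t * I)‖ = ‖g (σ + t * I)‖ * ‖k (σ + t * I)‖ := norm_mul _ _
      _ ≤ C * Real.exp ((Real.pi - δ) * |t|) * (4 * Real.pi * Real.exp (-(Real.pi * |t|))) :=
          mul_le_mul h1 h2 (norm_nonneg _) ((norm_nonneg _).trans h1)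
      _ = C * (4 * Real.pi) * (Real.exp ((Real.pi - δ) * |t|) * Real.exp (-(Real.pi * |t|))) := by
          ring
      _ = _ := by rw [← Real.exp_add]; ring_nf
  have hqb : ∀ σ ∈ Icc (-(1 / 2) : ℝ) (1 / 2), ∀ t : ℝ, 1 ≤ |t| →
      ‖q (σ + t * I)‖ ≤ (C * (4 * Real.pi) + ‖g 0‖ * (4 * Real.pi)) * Real.exp (-(δ * |t|)) := by
    intro σ hσ t ht
    have h3 : (σ + t * I : ℂ).im = t := by simp
    have hne : (σ + t * I : ℂ) ≠ 0 := by
      intro h0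
      rw [h0] at h3
      rw [← h3] at ht
      norm_num at ht
    have h2 := norm_pi_div_sin_le (s := σ + t * I) (by simpa using ht)
    rw [h3] at h2
    rw [hqne _ hne, add_mul]
    refine (norm_sub_le _ _).trans (add_le_add (hgk σ hσ t ht) ?_)
    rw [norm_mul, mul_assoc]
    gcongr
    refine h2.trans ?_
    gcongr
  have hline : ∀ σ : ℝ, σ = 1 / 2 ∨ σ = -(1 / 2) → ∀ t : ℝ, S (σ + t * I) ≠ 0 := by
    intro σ hσ t
    have hc : ((Real.cosh (Real.pi * t) : ℝ) : ℂ) ≠ 0 := ofReal_ne_zero.mpr (Real.cosh_pos _).ne'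
    rcases hσ with rfl | rfl
    · simp only [hS]; rw [sin_pi_mul_half_add]; exact hc
    · simp only [hS]; rw [sin_pi_mul_neg_half_add]; exact neg_ne_zero.mpr hc
  have hmem : ∀ σ : ℝ, σ = 1 / 2 ∨ σ = -(1 / 2) → σ ∈ Icc (-(1 / 2) : ℝ) (1 / 2) := by
    rintro σ (rfl | rfl) <;> norm_num
  have hkc : ∀ σ : ℝ, σ = 1 / 2 ∨ σ = -(1 / 2) → Continuous fun t : ℝ => k (σ + t * I) :=
    fun σ hσ => continuous_const.div (by fun_prop) (hline σ hσ)
  have hgki : ∀ σ : ℝ, σ = 1 / 2 ∨ σ = -(1 / 2) →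
      Integrable fun t : ℝ => g (σ + t * I) * k (σ + t * I) := fun σ hσ =>
    integrable_of_continuous_of_norm_le_exp
      ((hg.continuous.comp (by fun_prop)).mul (hkc σ hσ)) hδ (hgk σ (hmem σ hσ))
  obtain ⟨hci, hcv⟩ := integrable_and_integral_pi_div_cosh
  have hk1 : ∀ t : ℝ, k ((1 / 2 : ℝ) + t * I) = ((Real.pi / Real.cosh (Real.pi * t) : ℝ) : ℂ) := by
    intro t; simp only [hk]; rw [sin_pi_mul_half_add]; push_cast; rfl
  have hk2 : ∀ t : ℝ, k ((-(1 / 2) : ℝ) + t * I) =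
      -((Real.pi / Real.cosh (Real.pi * t) : ℝ) : ℂ) := by
    intro t; simp only [hk]; rw [sin_pi_mul_neg_half_add, div_neg]; push_cast; rfl
  have hshift := integral_vertical_eq (by norm_num) hqd hδ hqb
  have hqi : ∀ σ : ℝ, σ = 1 / 2 ∨ σ = -(1 / 2) → Integrable (fun t : ℝ => k (σ + t * I)) →
      ∫ t : ℝ, q (σ + t * I) =
        (∫ t : ℝ, g (σ + t * I) * k (σ + t * I)) - g 0 * ∫ t : ℝ, k (σ + t * I) := by
    intro σ hσ hki
    rw [← integral_const_mul, ← integral_sub (hgki σ hσ) (hki.const_mul _)]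
    refine integral_congr_ae (Eventually.of_forall fun t => hqne _ fun h0 => ?_)
    exact hline σ hσ t (by rw [h0, hS0])
  have hki1 : Integrable (fun t : ℝ => k ((1 / 2 : ℝ) + t * I)) := by
    simp_rw [hk1]; exact hci.ofReal
  have hki2 : Integrable (fun t : ℝ => k ((-(1 / 2) : ℝ) + t * I)) := by
    simp_rw [hk2]; exact hci.ofReal.neg
  have hv1 : ∫ t : ℝ, k ((1 / 2 : ℝ) + t * I) = Real.pi := by
    simp_rw [hk1]; rw [integral_complex_ofReal, hcv]
  have hv2 : ∫ t : ℝ, k ((-(1 / 2) : ℝ) + t * I) = -Real.pi := by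
    simp_rw [hk2]; rw [integral_neg, integral_complex_ofReal, hcv]
  rw [hqi _ (Or.inr rfl) hki2, hqi _ (Or.inl rfl) hki1, hv1, hv2] at hshift
  linear_combination -hshift

end Complex

end

/-! ### Bounds for Γ and 1/Γ on vertical lines with explicit dependence on the real part. -/

section

open Filter Topology MeasureTheory Set

lemma integral_Ioi_eq_integral_exp_smul {E : Type*} [NormedAddCommGroup E] [NormedSpace ℝ E]
    (F : ℝ → E) : ∫ x in Ioi (0 : ℝ), F x = ∫ u : ℝ, Real.exp u • F (Real.exp u) := by
  have h := integral_image_eq_integral_abs_deriv_smul (s := univ) (f := Real.exp)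
    (f' := Real.exp) MeasurableSet.univ (fun x _ => (Real.hasDerivAt_exp x).hasDerivWithinAt)
    Real.exp_injective.injOn F
  rw [image_univ, Real.range_exp] at h
  simpa using h

namespace Complex

lemma norm_GammaSeq (s : ℂ) {n : ℕ} (hn : 0 < n) :
    ‖GammaSeq s n‖ = (n : ℝ) ^ s.re * n.factorial / ∏ j ∈ Finset.range (n + 1), ‖s + j‖ := by
  rw [GammaSeq, norm_div, norm_mul, norm_prod, norm_natCast_cpow_of_pos hn, norm_natCast]

/-- In Euler's product formula this holds factor by factor: |a + iy| / a decreases in a > 0. Passing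
to the limit separates the dependence on x from that on y. -/
lemma Gamma_mul_norm_Gamma_one_add_le {x : ℝ} (hx : 1 ≤ x) (y : ℝ) :
    Real.Gamma x * ‖Gamma (1 + y * I)‖ ≤ ‖Gamma (x + y * I)‖ := by
  have h1 := (GammaSeq_tendsto_Gamma x).norm.mul (GammaSeq_tendsto_Gamma (1 + y * I)).norm
  have h2 := (GammaSeq_tendsto_Gamma (x + y * I)).norm.mul (GammaSeq_tendsto_Gamma 1).norm
  rw [Gamma_one, norm_one, mul_one] at h2
  rw [Gamma_ofReal, norm_real, Real.norm_eq_abs,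
    abs_of_pos (Real.Gamma_pos_of_pos (by linarith))] at h1
  refine le_of_tendsto_of_tendsto h1 h2 ?_
  filter_upwards [eventually_gt_atTop 0] with n hn
  rw [norm_GammaSeq _ hn, norm_GammaSeq _ hn, norm_GammaSeq _ hn, norm_GammaSeq _ hn]
  have hpos : ∀ a b : ℝ, 0 < a → 0 < ‖(a + b * I : ℂ)‖ := fun a b ha => by
    refine norm_pos_iff.mpr fun h => ?_
    have := congrArg re h
    simp at this
    exact ha.ne' this
  have key : ∀ a c : ℝ, 0 < c → c ≤ a → ‖(a + y * I : ℂ)‖ * c ≤ a * ‖(c + y * I : ℂ)‖ := by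
    intro a c hc hca
    have ha : 0 < a := hc.trans_le hca
    rw [norm_add_mul_I, norm_add_mul_I]
    refine abs_le_of_sq_le_sq' ?_ (by positivity) |>.2
    rw [mul_pow, mul_pow, Real.sq_sqrt (by positivity), Real.sq_sqrt (by positivity)]
    nlinarith [mul_nonneg (sq_nonneg y) (mul_nonneg (sub_nonneg.mpr hca) (add_pos ha hc).le)]
  have hprod : (∏ j ∈ Finset.range (n + 1), ‖(x + y * I : ℂ) + j‖) *
      (∏ j ∈ Finset.range (n + 1), ‖(1 : ℂ) + j‖) ≤
      (∏ j ∈ Finset.range (n + 1), ‖(x : ℂ) + j‖) *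
      (∏ j ∈ Finset.range (n + 1), ‖(1 + y * I : ℂ) + j‖) := by
    rw [← Finset.prod_mul_distrib, ← Finset.prod_mul_distrib]
    refine Finset.prod_le_prod (fun j _ => by positivity) fun j _ => ?_
    have e1 : (x + y * I : ℂ) + j = ((x + j : ℝ) : ℂ) + y * I := by push_cast; ring
    have e2 : (1 + y * I : ℂ) + j = ((1 + j : ℝ) : ℂ) + y * I := by push_cast; ring
    have e3 : ‖(1 : ℂ) + j‖ = 1 + j := by
      have : ((1 : ℂ) + j) = ((1 + j : ℝ) : ℂ) := by push_cast; ring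
      rw [this, norm_real, Real.norm_eq_abs, abs_of_pos (by positivity)]
    have e4 : ‖(x : ℂ) + j‖ = x + j := by
      have : ((x : ℂ) + j) = ((x + j : ℝ) : ℂ) := by push_cast; ring
      rw [this, norm_real, Real.norm_eq_abs, abs_of_pos (by positivity)]
    rw [e1, e2, e3, e4]
    exact key _ _ (by positivity) (by linarith)
  have hp : ∀ w : ℂ, 0 < w.re → 0 < ∏ j ∈ Finset.range (n + 1), ‖w + j‖ := fun w hw =>
    Finset.prod_pos fun j _ => norm_pos_iff.mpr fun h => by
      have := congrArg re h
      simp at this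
      have hj : (0 : ℝ) ≤ j := by positivity
      linarith
  have p1 := hp x (by simp; linarith)
  have p2 := hp (1 + y * I) (by simp)
  have p3 := hp (x + y * I) (by simp; linarith)
  have p4 := hp 1 (by simp)
  rw [div_mul_div_comm, div_mul_div_comm, div_le_div_iff₀ (by positivity) (by positivity)]
  have e5 : (x + y * I : ℂ).re = x := by simp
  have e6 : (1 + y * I : ℂ).re = 1 := by simp
  rw [e5, e6, ofReal_re, one_re]
  gcongr

/-- The reflection formula gives |Γ(1 + iy)|² = π|y| / |sinh(πy)|, and sinh a ≤ a e^a for a ≥ 0. -/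
lemma exp_neg_le_norm_Gamma_one_add_mul_I (y : ℝ) :
    Real.exp (-(Real.pi / 2 * |y|)) ≤ ‖Gamma (1 + y * I)‖ := by
  rcases eq_or_ne y 0 with rfl | hy
  · simp
  have hpi := Real.pi_pos
  have hyI : (y * I : ℂ) ≠ 0 := mul_ne_zero (ofReal_ne_zero.mpr hy) I_ne_zero
  have hconj : ‖Gamma (1 - y * I)‖ = ‖Gamma (1 + y * I)‖ := by
    rw [← norm_conj (Gamma (1 + y * I)), ← Gamma_conj]
    congr 2
    simp [sub_eq_add_neg]
  have hsq : ‖Gamma (1 + y * I)‖ ^ 2 = |y| * (Real.pi / |Real.sinh (Real.pi * y)|) := by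
    have h := Gamma_mul_Gamma_one_sub (y * I)
    have h' : Gamma (1 + y * I) * Gamma (1 - y * I) = y * I * (Real.pi / sin (Real.pi * (y * I))) := by
      rw [← h, add_comm, Gamma_add_one _ hyI, mul_assoc]
    have h'' := congrArg norm h'
    rw [norm_mul, hconj, norm_mul, norm_div, norm_mul, norm_I, ← mul_assoc, sin_mul_I, norm_mul,
      norm_I, norm_real, norm_real, ← ofReal_mul, ← ofReal_sinh, norm_real] at h''
    rw [sq, h'']
    simp [abs_of_pos hpi]
  have hsinh : |Real.sinh (Real.pi * y)| ≤ Real.pi * |y| * Real.exp (Real.pi * |y|) := by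
    rw [Real.abs_sinh, abs_mul, abs_of_pos hpi, Real.sinh_eq]
    set a := Real.pi * |y|
    have h1 := Real.add_one_le_exp (-(2 * a))
    have h2 : Real.exp (-a) = Real.exp a * Real.exp (-(2 * a)) := by
      rw [← Real.exp_add]; ring_nf
    rw [h2]
    nlinarith [Real.exp_pos a]
  have hsinh0 : 0 < |Real.sinh (Real.pi * y)| := by
    rw [abs_pos, Ne, Real.sinh_eq_zero]
    exact mul_ne_zero hpi.ne' hy
  have hy0 : 0 < |y| := abs_pos.mpr hy
  refine abs_le_of_sq_le_sq' ?_ (norm_nonneg _) |>.2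
  rw [hsq, ← Real.exp_nat_mul]
  calc Real.exp ((2 : ℕ) * -(Real.pi / 2 * |y|)) = Real.exp (-(Real.pi * |y|)) := by
        congr 1; push_cast; ring
    _ = |y| * (Real.pi / (Real.pi * |y| * Real.exp (Real.pi * |y|))) := by
        rw [Real.exp_neg]; field_simp
    _ ≤ _ := by gcongr

lemma Gamma_mul_exp_neg_le_norm_Gamma {x : ℝ} (hx : 1 ≤ x) (y : ℝ) :
    Real.Gamma x * Real.exp (-(Real.pi / 2 * |y|)) ≤ ‖Gamma (x + y * I)‖ := by
  refine le_trans ?_ (Gamma_mul_norm_Gamma_one_add_le hx y)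
  have := Real.Gamma_pos_of_pos (show 0 < x by linarith)
  gcongr
  exact exp_neg_le_norm_Gamma_one_add_mul_I y

lemma norm_inv_Gamma_le {x : ℝ} (hx : 1 ≤ x) (y : ℝ) :
    ‖(Gamma (x + y * I))⁻¹‖ ≤ (Real.Gamma x)⁻¹ * Real.exp (Real.pi / 2 * |y|) := by
  have := Real.Gamma_pos_of_pos (show 0 < x by linarith)
  rw [norm_inv, ← inv_inv (Real.exp _), ← Real.exp_neg, ← mul_inv]
  exact inv_anti₀ (by positivity) (Gamma_mul_exp_neg_le_norm_Gamma hx y)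

lemma Gamma_eq_integral_exp {s : ℂ} (hs : 0 < s.re) :
    Gamma s = ∫ u : ℝ, cexp (s * u - cexp u) := by
  rw [Gamma_eq_integral hs, GammaIntegral, integral_Ioi_eq_integral_exp_smul]
  congr 1
  ext u
  rw [real_smul, cpow_def_of_ne_zero (by simp), ← ofReal_log (Real.exp_pos u).le,
    Real.log_exp, ofReal_exp, ofReal_exp, ← Complex.exp_add, ← Complex.exp_add]
  push_cast
  ring_nf

lemma integral_exp_mul_sub_mul_exp {σ c : ℝ} (hσ : 0 < σ) (hc : 0 < c) :
    ∫ u : ℝ, Real.exp (σ * u - c * Real.exp u) = Real.Gamma σ / c ^ σ := by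
  have h := Real.integral_rpow_mul_exp_neg_mul_Ioi hσ hc
  rw [integral_Ioi_eq_integral_exp_smul] at h
  rw [one_div, Real.inv_rpow hc.le, mul_comm, ← div_eq_mul_inv] at h
  rw [← h]
  congr 1
  ext u
  rw [smul_eq_mul, ← Real.exp_mul, ← Real.exp_add, ← Real.exp_add]
  ring_nf

/-- Rotating the line of integration in Euler's integral by the angle `θ`. -/
lemma norm_Gamma_le {x θ : ℝ} (hx : 0 < x) (hθ : 0 ≤ θ) (hθ' : θ < Real.pi / 2) (y : ℝ) :
    ‖Gamma (x + y * I)‖ ≤ Real.Gamma x / Real.cos θ ^ x * Real.exp (-(θ * |y|)) := by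
  wlog hy : y ≤ 0 generalizing y
  · have h := this (-y) (by linarith)
    rw [abs_neg] at h
    rwa [← norm_conj, ← Gamma_conj, show (starRingEnd ℂ) (x + y * I) = x + (-y : ℝ) * I by simp]
  set c := Real.cos θ with hc
  have hc0 : 0 < c := Real.cos_pos_of_mem_Ioo ⟨by linarith, hθ'⟩
  set s : ℂ := x + y * I with hs
  -- After the substitution e^u, rotating the ray by an angle becomes shifting a line. The factor -I
  -- makes that line vertical, with the angle as its real part.
  set ψ : ℂ → ℂ := fun w => cexp (s * (-I * w) - cexp (-I * w)) with hψ
  have hnorm : ∀ φ t : ℝ, ‖ψ (φ + t * I)‖ = Real.exp (x * t + y * φ - Real.cos φ * Real.exp t) := by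
    intro φ t
    have e : -I * (φ + t * I) = t - φ * I := by
      linear_combination (-t : ℂ) * I_sq
    rw [hψ]
    simp only
    rw [e, norm_exp, sub_re, exp_re, hs]
    simp
    ring
  have hexp : ∀ t : ℝ, 1 ≤ |t| → Real.exp (x * t - c * Real.exp t) ≤
      Real.exp (2 * x ^ 2 / c) * Real.exp (-(x * |t|)) := by
    intro t ht
    rw [← Real.exp_add, Real.exp_le_exp]
    have h0 := Real.exp_pos t
    have h3 : 0 ≤ 2 * x ^ 2 / c := by positivity
    rcases abs_cases t with ⟨h, h'⟩ | ⟨h, h'⟩ <;> rw [h]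
    · have h1 := Real.quadratic_le_exp_of_nonneg h'
      -- Completing the square: the quadratic term of e^t beats the linear term 2xt.
      have h2 : 2 * x * t - c * (t ^ 2 / 2) ≤ 2 * x ^ 2 / c := by
        rw [le_div_iff₀ hc0]
        nlinarith [sq_nonneg (c * t - 2 * x)]
      nlinarith [mul_le_mul_of_nonneg_left h1 hc0.le]
    · nlinarith
  have hshift := integral_vertical_eq (φ := ψ) (a := 0) (b := θ) hθ
    (by fun_prop : Differentiable ℂ ψ).differentiableOn
    (C := Real.exp (2 * x ^ 2 / c)) hx (by
      rintro φ ⟨hφ, hφ'⟩ t ht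
      rw [hnorm]
      refine le_trans ?_ (hexp t ht)
      rw [Real.exp_le_exp]
      have h1 : c ≤ Real.cos φ := Real.cos_le_cos_of_nonneg_of_le_pi hφ (by linarith) hφ'
      have h2 : y * φ ≤ 0 := mul_nonpos_of_nonpos_of_nonneg hy hφ
      nlinarith [mul_le_mul_of_nonneg_right h1 (Real.exp_pos t).le])
  have hG : Gamma s = ∫ t : ℝ, ψ ((0 : ℝ) + t * I) := by
    rw [Gamma_eq_integral_exp (by simpa [hs] using hx)]
    congr 1
    ext t
    have e : -I * (((0 : ℝ) : ℂ) + t * I) = t := by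
      push_cast
      linear_combination (-t : ℂ) * I_sq
    simp only [hψ]
    rw [e]
  rw [hG, hshift]
  refine (norm_integral_le_integral_norm _).trans (le_of_eq ?_)
  simp_rw [hnorm]
  rw [← integral_exp_mul_sub_mul_exp hx hc0, abs_of_nonpos hy, ← integral_mul_const]
  congr 1
  ext t
  rw [← Real.exp_add, ← hc]
  ring_nf

lemma norm_inv_Gamma_le_of_re_lt_one {z : ℂ} (hz : z.re < 1) :
    ‖(Gamma z)⁻¹‖ ≤ Real.exp (Real.pi * |z.im|) * ‖Gamma (1 - z)‖ / Real.pi := by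
  have hpi := Real.pi_pos
  rcases eq_or_ne (Gamma z) 0 with h0 | h0
  · rw [h0, inv_zero, norm_zero]; positivity
  have h1 : Gamma (1 - z) ≠ 0 := Gamma_ne_zero_of_re_pos (by simpa using hz)
  have h := Gamma_mul_Gamma_one_sub z
  have hs : sin (Real.pi * z) ≠ 0 := by
    intro hs
    rw [hs, div_zero] at h
    exact mul_ne_zero h0 h1 h
  have e : (Gamma z)⁻¹ = sin (Real.pi * z) * Gamma (1 - z) / Real.pi := by
    rw [eq_div_iff hs] at h
    have : (Real.pi : ℂ) ≠ 0 := ofReal_ne_zero.mpr hpi.ne'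
    field_simp
    linear_combination -h
  rw [e, norm_div, norm_mul, norm_real, Real.norm_eq_abs, abs_of_pos hpi]
  have h2 := norm_sin_le_exp (Real.pi * z)
  have h3 : |((Real.pi : ℂ) * z).im| = Real.pi * |z.im| := by simp [abs_mul, abs_of_pos hpi]
  rw [h3] at h2
  gcongr

/-- The growth of `1 / Γ` in vertical strips. -/
lemma exists_norm_inv_Gamma_le (A B : ℝ) {ε : ℝ} (hε : 0 < ε) :
    ∃ C, 0 ≤ C ∧ ∀ σ ∈ Icc A B, ∀ t : ℝ,
      ‖(Gamma (σ + t * I))⁻¹‖ ≤ C * Real.exp ((Real.pi / 2 + ε) * |t|) := by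
  -- Induction on how far the strip reaches to the left of 1, through 1/Γ(z) = z/Γ(z + 1). The
  -- linear factor is absorbed by half of ε at each step.
  have main : ∀ M : ℕ, ∀ A B ε : ℝ, 0 < ε → 1 - M ≤ A → ∃ C, 0 ≤ C ∧ ∀ σ ∈ Icc A B, ∀ t : ℝ,
      ‖(Gamma (σ + t * I))⁻¹‖ ≤ C * Real.exp ((Real.pi / 2 + ε) * |t|) := by
    intro M
    induction M with
    | zero =>
      intro A B ε hε hA
      refine ⟨Real.exp 2, by positivity, fun σ hσ t => ?_⟩
      have hσ1 : 1 ≤ σ := by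
        have := hσ.1; push_cast at hA; linarith
      have h1 := Real.rpow_mul_exp_neg_le_Gamma one_pos hσ1
      rw [Real.one_rpow, one_mul, show (1 : ℝ) + 1 = 2 by norm_num] at h1
      refine (norm_inv_Gamma_le hσ1 t).trans ?_
      have h2 : (Real.Gamma σ)⁻¹ ≤ Real.exp 2 := by
        rw [← inv_inv (Real.exp 2), ← Real.exp_neg]
        exact inv_anti₀ (Real.exp_pos _) h1
      gcongr
      linarith
    | succ M ih =>
      intro A B ε hε hA
      obtain ⟨C, hC, h⟩ := ih (A + 1) (B + 1) (ε / 2) (by positivity) (by push_cast at hA; linarith)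
      refine ⟨(|A| + |B| + 2 / ε) * C, by positivity, fun σ hσ t => ?_⟩
      have h1 := h (σ + 1) ⟨by linarith [hσ.1], by linarith [hσ.2]⟩ t
      have e : (((σ + 1 : ℝ) : ℂ) + t * I) = σ + t * I + 1 := by push_cast; ring
      rw [e] at h1
      rw [one_div_Gamma_eq_self_mul_one_div_Gamma_add_one, norm_mul]
      have h2 : ‖(σ + t * I : ℂ)‖ ≤ (|A| + |B| + 2 / ε) * Real.exp (ε / 2 * |t|) := by
        have h3 : ‖(σ + t * I : ℂ)‖ ≤ |σ| + |t| := by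
          refine (norm_add_le _ _).trans ?_
          simp
        have h4 : |σ| ≤ |A| + |B| := abs_le.mpr
          ⟨by linarith [hσ.1, neg_abs_le A, abs_nonneg B],
            by linarith [hσ.2, le_abs_self B, abs_nonneg A]⟩
        have h5 := Real.add_one_le_exp (ε / 2 * |t|)
        have h6 : 1 ≤ Real.exp (ε / 2 * |t|) := Real.one_le_exp (by positivity)
        have h7 : |t| ≤ 2 / ε * Real.exp (ε / 2 * |t|) := by
          rw [div_mul_eq_mul_div, le_div_iff₀ hε]
          linarith
        nlinarith [abs_nonneg A, abs_nonneg B]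
      calc ‖(σ + t * I : ℂ)‖ * ‖(Gamma (σ + t * I + 1))⁻¹‖
          ≤ ((|A| + |B| + 2 / ε) * Real.exp (ε / 2 * |t|)) *
            (C * Real.exp ((Real.pi / 2 + ε / 2) * |t|)) := by gcongr
        _ = (|A| + |B| + 2 / ε) * C *
            (Real.exp (ε / 2 * |t|) * Real.exp ((Real.pi / 2 + ε / 2) * |t|)) := by ring
        _ = _ := by rw [← Real.exp_add]; ring_nf
  obtain ⟨M, hM⟩ := exists_nat_ge (1 - A)
  exact main M A B ε hε (by linarith)

end Complex

end

/-! ### Gauss's multiplication formula from Euler's limit and Stirling's formula. -/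

section

open Filter Topology

lemma Finset.prod_range_mul_add {M : Type*} [CommMonoid M] (f : ℕ → M) (k n : ℕ) :
    ∏ i ∈ range (k * n), f i = ∏ j ∈ range k, ∏ m ∈ range n, f (k * m + j) := by
  induction n with
  | zero => simp
  | succ n ih =>
    rw [Nat.mul_succ, prod_range_add, ih, ← prod_mul_distrib]
    exact prod_congr rfl fun j _ => (prod_range_succ _ _).symm

lemma Stirling.factorial_eq_stirlingSeq_mul {n : ℕ} (hn : 0 < n) :
    (n.factorial : ℝ) = stirlingSeq n * (√(2 * n) * (n / Real.exp 1) ^ n) := by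
  rw [stirlingSeq, div_mul_cancel₀]
  positivity

namespace Complex

/-- Writing both factorials through `stirlingSeq` cancels all growing powers and isolates a ratio
whose limit is the constant in Gauss's formula. Here m + 1 is the number of factors. -/
lemma factorial_pow_eq_stirlingSeq (m : ℕ) {n : ℕ} (hn : 0 < n) :
    √n ^ m * (n.factorial : ℝ) ^ (m + 1) * ((m + 1 : ℕ) : ℝ) ^ ((m + 1) * (n + 1)) =
      Stirling.stirlingSeq n ^ (m + 1) / Stirling.stirlingSeq ((m + 1) * n) * (√2 ^ m * √(m + 1 : ℕ)) *
        ((((m + 1) * n).factorial : ℝ) * (((m + 1 : ℕ) : ℝ) * n) ^ m) := by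
  have hkn : 0 < (m + 1) * n := by positivity
  have hS : 0 < Stirling.stirlingSeq ((m + 1) * n) := by
    obtain ⟨p, hp⟩ := Nat.exists_eq_succ_of_ne_zero hkn.ne'
    rw [hp]; exact Stirling.stirlingSeq'_pos p
  rw [Stirling.factorial_eq_stirlingSeq_mul hn, Stirling.factorial_eq_stirlingSeq_mul hkn]
  generalize hk : m + 1 = k at *
  have hk0 : (0 : ℝ) < k := by rw [← hk]; positivity
  have hn0 : (0 : ℝ) < n := by positivity
  push_cast
  rw [Real.sqrt_mul (by positivity), Real.sqrt_mul (by positivity), Real.sqrt_mul (by positivity)]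
  obtain ⟨a, ha, hak⟩ : ∃ a : ℝ, 0 < a ∧ (k : ℝ) = a ^ 2 :=
    ⟨√k, by positivity, (Real.sq_sqrt hk0.le).symm⟩
  obtain ⟨b, hb, hbn⟩ : ∃ b : ℝ, 0 < b ∧ (n : ℝ) = b ^ 2 :=
    ⟨√n, by positivity, (Real.sq_sqrt hn0.le).symm⟩
  have h2 : 0 < √(2 : ℝ) := by positivity
  rw [hak, hbn, Real.sqrt_sq ha.le, Real.sqrt_sq hb.le]
  generalize √(2 : ℝ) = c at *
  generalize Stirling.stirlingSeq (k * n) = S at *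
  have e := Real.exp_pos 1
  generalize Real.exp 1 = E at *
  rw [mul_div_assoc (a ^ 2), mul_pow (a ^ 2) (b ^ 2 / E), mul_add, mul_one, pow_add (a ^ 2),
    mul_pow, mul_pow (c * b), ← pow_mul (b ^ 2 / E) n k, mul_comm n k]
  generalize hX : (b ^ 2 / E) ^ (k * n) = X
  generalize hY : (a ^ 2) ^ (k * n) = Y
  rw [← hk]
  field_simp
  ring

lemma tendsto_stirlingSeq_ratio (m : ℕ) :
    Tendsto (fun n : ℕ => Stirling.stirlingSeq n ^ (m + 1) /
      Stirling.stirlingSeq ((m + 1) * n) * (√2 ^ m * √(m + 1 : ℕ))) atTop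
      (𝓝 (√(2 * Real.pi) ^ m * √(m + 1 : ℕ))) := by
  have h := Stirling.tendsto_stirlingSeq_sqrt_pi
  have hpi : 0 < √Real.pi := Real.sqrt_pos.mpr Real.pi_pos
  have h' := h.comp (tendsto_id.const_mul_atTop' (show 0 < m + 1 by positivity))
  have h'' := ((h.pow (m + 1)).div h' hpi.ne').mul_const (√2 ^ m * √(m + 1 : ℕ))
  convert! h'' using 2
  rw [Real.sqrt_mul (by positivity), mul_pow]
  field_simp
  exact (pow_succ _ _).symm

lemma prod_natCast_cpow {n : ℕ} (hn : 0 < n) (z : ℂ) (m : ℕ) :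
    ∏ j ∈ Finset.range (m + 1), (n : ℂ) ^ (z + j / (m + 1 : ℕ)) =
      (n : ℂ) ^ ((m + 1 : ℕ) * z) * ((√n ^ m : ℝ) : ℂ) := by
  have hn0 : (n : ℂ) ≠ 0 := by exact_mod_cast hn.ne'
  have h1 : ((√n ^ m : ℝ) : ℂ) = (n : ℂ) ^ ((m : ℂ) / 2) := by
    rw [Real.sqrt_eq_rpow, ← Real.rpow_natCast, ← Real.rpow_mul (by positivity),
      ofReal_cpow (by positivity)]
    push_cast
    ring_nf
  rw [h1, ← cpow_add _ _ hn0]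
  simp_rw [cpow_def_of_ne_zero hn0]
  rw [← exp_sum, ← Finset.mul_sum, Finset.sum_add_distrib, Finset.sum_const, Finset.card_range,
    nsmul_eq_mul, ← Finset.sum_div]
  have h2 : (∑ j ∈ Finset.range (m + 1), (j : ℂ)) * 2 = (m + 1 : ℕ) * m := by
    have := Finset.sum_range_id_mul_two (m + 1)
    rw [Nat.add_sub_cancel] at this
    have := congrArg (Nat.cast : ℕ → ℂ) this
    push_cast at this ⊢
    exact this
  have h3 : ((m + 1 : ℕ) : ℂ) ≠ 0 := by exact_mod_cast Nat.succ_ne_zero m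
  congr 2
  rw [add_right_inj, div_eq_div_iff h3 two_ne_zero, h2]
  ring

/-- Gauss's formula at finite level: the residue classes modulo m + 1 interleave into one product.
That product has (m + 1)(n + 1) factors, m more than `GammaSeq` at (m + 1)n uses, and the surplus
forms the correction product. -/
lemma prod_GammaSeq_add_div (m : ℕ) (z : ℂ) {n : ℕ} (hn : 0 < n)
    (hne : ∀ i ∈ Finset.range m, ((m + 1 : ℕ) : ℂ) * z + (((m + 1) * n + 1 + i : ℕ) : ℂ) ≠ 0) :
    ∏ j ∈ Finset.range (m + 1), GammaSeq (z + j / (m + 1 : ℕ)) n =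
      ((Stirling.stirlingSeq n ^ (m + 1) / Stirling.stirlingSeq ((m + 1) * n) *
        (√2 ^ m * √(m + 1 : ℕ)) : ℝ) : ℂ) * ((m + 1 : ℕ) : ℂ) ^ (-(((m + 1 : ℕ) : ℂ) * z)) *
      (∏ i ∈ Finset.range m, (((m + 1 : ℕ) : ℂ) * n) /
        (((m + 1 : ℕ) : ℂ) * z + (((m + 1) * n + 1 + i : ℕ) : ℂ))) *
      GammaSeq ((m + 1 : ℕ) * z) ((m + 1) * n) := by
  have hk0 : ((m + 1 : ℕ) : ℂ) ≠ 0 := by exact_mod_cast Nat.succ_ne_zero m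
  have hn0 : (n : ℂ) ≠ 0 := by exact_mod_cast hn.ne'
  have hden : ∏ j ∈ Finset.range (m + 1), ∏ i ∈ Finset.range (n + 1),
      (z + j / (m + 1 : ℕ) + i) =
      ((∏ i ∈ Finset.range ((m + 1) * n + 1), (((m + 1 : ℕ) : ℂ) * z + i)) *
        ∏ i ∈ Finset.range m, (((m + 1 : ℕ) : ℂ) * z + (((m + 1) * n + 1 + i : ℕ) : ℂ))) /
        ((m + 1 : ℕ) : ℂ) ^ ((m + 1) * (n + 1)) := by
    rw [← Finset.prod_range_add (fun i : ℕ => ((m + 1 : ℕ) : ℂ) * z + i),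
      show (m + 1) * n + 1 + m = (m + 1) * (n + 1) by ring, eq_div_iff (pow_ne_zero _ hk0),
      Finset.prod_range_mul_add]
    have hcard : ((m + 1 : ℕ) : ℂ) ^ ((m + 1) * (n + 1)) =
        ∏ j ∈ Finset.range (m + 1), ∏ i ∈ Finset.range (n + 1), ((m + 1 : ℕ) : ℂ) := by
      simp [← pow_mul, mul_comm]
    rw [hcard, ← Finset.prod_mul_distrib]
    refine Finset.prod_congr rfl fun j _ => ?_
    rw [← Finset.prod_mul_distrib]
    refine Finset.prod_congr rfl fun i _ => ?_
    rw [Nat.cast_add ((m + 1) * i), Nat.cast_mul]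
    field_simp
    ring
  have hnum := congrArg (fun x : ℝ => (x : ℂ)) (factorial_pow_eq_stirlingSeq m hn)
  simp only [ofReal_mul, ofReal_pow, ofReal_natCast] at hnum
  simp only [GammaSeq]
  rw [Finset.prod_div_distrib, hden, Finset.prod_mul_distrib, prod_natCast_cpow hn,
    Finset.prod_const, Finset.card_range, Nat.cast_mul, natCast_mul_natCast_cpow, cpow_neg,
    Finset.prod_div_distrib, Finset.prod_const, Finset.card_range]
  have hp : ∏ i ∈ Finset.range m,
      (((m + 1 : ℕ) : ℂ) * z + (((m + 1) * n + 1 + i : ℕ) : ℂ)) ≠ 0 :=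
    Finset.prod_ne_zero_iff.mpr hne
  have hkz : ((m + 1 : ℕ) : ℂ) ^ (((m + 1 : ℕ) : ℂ) * z) ≠ 0 := by
    rw [Ne, cpow_eq_zero_iff]
    exact fun h => hk0 h.1
  simp only [ofReal_mul, ofReal_pow]
  generalize ((Stirling.stirlingSeq n ^ (m + 1) / Stirling.stirlingSeq ((m + 1) * n) : ℝ) : ℂ) = A
    at *
  generalize ((√(m + 1 : ℕ) : ℝ) : ℂ) = B at *
  generalize ((√2 : ℝ) : ℂ) ^ m = D at *
  generalize ((√n : ℝ) : ℂ) ^ m = E at *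
  generalize (n.factorial : ℂ) ^ (m + 1) = F at *
  generalize (((m + 1) * n).factorial : ℂ) = G at *
  generalize ∏ i ∈ Finset.range m,
      (((m + 1 : ℕ) : ℂ) * z + (((m + 1) * n + 1 + i : ℕ) : ℂ)) = U at *
  generalize ∏ i ∈ Finset.range ((m + 1) * n + 1), (((m + 1 : ℕ) : ℂ) * z + i) = V at *
  generalize ((m + 1 : ℕ) : ℂ) ^ (((m + 1 : ℕ) : ℂ) * z) = W at *
  generalize (n : ℂ) ^ (((m + 1 : ℕ) : ℂ) * z) = W' at *
  generalize ((m + 1 : ℕ) : ℂ) ^ ((m + 1) * (n + 1)) = T at *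
  generalize (((m + 1 : ℕ) : ℂ) * n) ^ m = R at *
  calc W' * E * F / (V * U / T) = (E * F * T) * W' / (V * U) := by
        rw [div_div_eq_mul_div]; ring
    _ = A * (D * B) * (G * R) * W' / (V * U) := by rw [hnum]
    _ = _ := by
        -- V = 0 means that a pole is met. Both sides are then 0 by the convention for division, so
        -- no exclusion on z is needed.
        by_cases hV : V = 0
        · simp [hV]
        · field_simp

/-- **Gauss's multiplication formula**, with both sides `0` at the poles. -/
theorem prod_Gamma_add_div {k : ℕ} (hk : 0 < k) (z : ℂ) :
    ∏ j ∈ Finset.range k, Gamma (z + j / k) =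
      (((2 * Real.pi) ^ (((k : ℝ) - 1) / 2) * √k : ℝ) : ℂ) * (k : ℂ) ^ (-(k * z)) *
        Gamma (k * z) := by
  obtain ⟨m, rfl⟩ := Nat.exists_eq_succ_of_ne_zero hk.ne'
  rw [Nat.succ_eq_add_one]
  have hconst : (2 * Real.pi) ^ ((((m + 1 : ℕ) : ℝ) - 1) / 2) = √(2 * Real.pi) ^ m := by
    rw [Real.sqrt_eq_rpow, ← Real.rpow_natCast, ← Real.rpow_mul (by positivity)]
    push_cast
    ring_nf
  rw [hconst]
  have h1 : Tendsto (fun n => ∏ j ∈ Finset.range (m + 1), GammaSeq (z + j / (m + 1 : ℕ)) n) atTop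
      (𝓝 (∏ j ∈ Finset.range (m + 1), Gamma (z + j / (m + 1 : ℕ)))) :=
    tendsto_finsetProd _ fun j _ => GammaSeq_tendsto_Gamma _
  have hmul : Tendsto (fun n : ℕ => (m + 1) * n) atTop atTop :=
    tendsto_id.const_mul_atTop' (show 0 < m + 1 by positivity)
  have h2 := (GammaSeq_tendsto_Gamma ((m + 1 : ℕ) * z)).comp hmul
  have hinv : ∀ w : ℂ, Tendsto (fun n : ℕ => w / (((m + 1 : ℕ) : ℂ) * n)) atTop (𝓝 0) := by
    intro w
    have h := (tendsto_inv_atTop_nhds_zero_nat (𝕜 := ℂ)).comp hmul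
    simpa [div_eq_mul_inv] using h.const_mul w
  have hadd : ∀ i : ℕ, Tendsto (fun n : ℕ =>
      1 + (((m + 1 : ℕ) : ℂ) * z + (1 + i)) / (((m + 1 : ℕ) : ℂ) * n)) atTop (𝓝 1) := by
    intro i
    simpa using (hinv (((m + 1 : ℕ) : ℂ) * z + (1 + i))).const_add 1
  have hrew : ∀ i n : ℕ, 0 < n → ((m + 1 : ℕ) : ℂ) * z + (((m + 1) * n + 1 + i : ℕ) : ℂ) =
      (((m + 1 : ℕ) : ℂ) * n) *
        (1 + (((m + 1 : ℕ) : ℂ) * z + (1 + i)) / (((m + 1 : ℕ) : ℂ) * n)) := by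
    intro i n hn
    have hkn : ((m + 1 : ℕ) : ℂ) * n ≠ 0 :=
      mul_ne_zero (by exact_mod_cast Nat.succ_ne_zero m) (by exact_mod_cast hn.ne')
    rw [mul_add, mul_div_cancel₀ _ hkn]
    push_cast
    ring
  have h3 : Tendsto (fun n : ℕ => ∏ i ∈ Finset.range m, (((m + 1 : ℕ) : ℂ) * n) /
        (((m + 1 : ℕ) : ℂ) * z + (((m + 1) * n + 1 + i : ℕ) : ℂ))) atTop (𝓝 1) := by
    rw [show (1 : ℂ) = ∏ i ∈ Finset.range m, (1 : ℂ)⁻¹ by simp]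
    refine tendsto_finsetProd _ fun i _ => ((hadd i).inv₀ one_ne_zero).congr' ?_
    filter_upwards [eventually_gt_atTop 0] with n hn
    have hkn : ((m + 1 : ℕ) : ℂ) * n ≠ 0 :=
      mul_ne_zero (by exact_mod_cast Nat.succ_ne_zero m) (by exact_mod_cast hn.ne')
    rw [hrew i n hn, div_mul_cancel_left₀ hkn]
  have h4 := (((continuous_ofReal.tendsto _).comp (tendsto_stirlingSeq_ratio m)).mul_const
    (((m + 1 : ℕ) : ℂ) ^ (-(((m + 1 : ℕ) : ℂ) * z)))).mul h3 |>.mul h2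
  rw [mul_one] at h4
  refine tendsto_nhds_unique h1 (h4.congr' ?_)
  -- The surplus factors, after division by (m + 1)n, tend to 1 and so are eventually nonzero.
  have hne : ∀ᶠ n : ℕ in atTop, ∀ i ∈ Finset.range m,
      1 + (((m + 1 : ℕ) : ℂ) * z + (1 + i)) / (((m + 1 : ℕ) : ℂ) * n) ≠ 0 :=
    (Finset.eventually_all _).mpr fun i _ => (hadd i).eventually_ne one_ne_zero
  filter_upwards [eventually_gt_atTop 0, hne] with n hn hne
  refine (prod_GammaSeq_add_div m z hn fun i hi => ?_).symm
  rw [hrew i n hn]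
  exact mul_ne_zero (mul_ne_zero (by exact_mod_cast Nat.succ_ne_zero m)
    (by exact_mod_cast hn.ne')) (hne i hi)

end Complex

end

/-! ### The Mellin transform of the weight and the residue series. -/

section

open Filter Topology MeasureTheory Set Complex

/-- The Mellin transform `Γ(s) / Γ(b + α s) ^ n` of the weight function. -/
noncomputable def leRoyMellin (n : ℕ) (α b : ℝ) (s : ℂ) : ℂ :=
  Gamma s * (Gamma (b + α * s))⁻¹ ^ n

/-- The entire function whose product with `π / sin (π s)` is `y ^ (-s) * leRoyMellin n α b s`. -/
noncomputable def leRoyEntire (n : ℕ) (α b y : ℝ) (s : ℂ) : ℂ :=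
  (y : ℂ) ^ (-s) * ((Gamma (1 - s))⁻¹ * (Gamma (b + α * s))⁻¹ ^ n)

/-- A rate of exponential decay of `leRoyMellin` along vertical lines. -/
noncomputable def leRoyDecay (n : ℕ) (α : ℝ) : ℝ := Real.pi / 4 * (1 - n * α)

section

variable {n : ℕ} {α : ℝ}

lemma leRoyDecay_pos (h : n * α < 1) : 0 < leRoyDecay n α :=
  mul_pos (by positivity) (by linarith)

lemma leRoyDecay_le (hα : 0 < α) : leRoyDecay n α ≤ Real.pi / 4 := by
  have : 0 ≤ n * α := by positivity
  rw [leRoyDecay]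
  nlinarith [Real.pi_pos]

lemma differentiable_leRoyEntire (n : ℕ) (α b : ℝ) {y : ℝ} (hy : 0 < y) :
    Differentiable ℂ (leRoyEntire n α b y) := by
  have hy0 : (y : ℂ) ≠ 0 := ofReal_ne_zero.mpr hy.ne'
  have h1 : Differentiable ℂ fun s : ℂ => (y : ℂ) ^ (-s) := fun s =>
    (differentiableAt_id.neg).const_cpow (Or.inl hy0)
  have h2 : Differentiable ℂ fun s : ℂ => (Gamma (1 - s))⁻¹ :=
    differentiable_one_div_Gamma.comp (by fun_prop)
  have h3 : Differentiable ℂ fun s : ℂ => (Gamma (b + α * s))⁻¹ :=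
    differentiable_one_div_Gamma.comp (f := fun s : ℂ => (b : ℂ) + α * s) (by fun_prop)
  exact h1.mul (h2.mul (h3.pow n))

lemma exists_norm_leRoyEntire_le (hα : 0 < α) (hnα : n * α < 1) (b A B : ℝ) {y : ℝ} (hy : 0 < y) :
    ∃ C, 0 ≤ C ∧ ∀ σ ∈ Icc A B, ∀ t : ℝ, ‖leRoyEntire n α b y (σ + t * I)‖ ≤
      C * Real.exp ((Real.pi - leRoyDecay n α) * |t|) := by
  set δ := leRoyDecay n α with hδ
  have hδ0 : 0 < δ := leRoyDecay_pos hnα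
  obtain ⟨C₁, hC₁, h₁⟩ := exists_norm_inv_Gamma_le (1 - B) (1 - A) (half_pos hδ0)
  obtain ⟨C₂, hC₂, h₂⟩ := exists_norm_inv_Gamma_le (b + α * A) (b + α * B) (half_pos hδ0)
  refine ⟨(y ^ (-A) + y ^ (-B)) * (C₁ * C₂ ^ n), by positivity, fun σ hσ t => ?_⟩
  have e1 : (1 - (σ + t * I) : ℂ) = ((1 - σ : ℝ) : ℂ) + (-t : ℝ) * I := by push_cast; ring
  have e2 : (b + α * (σ + t * I) : ℂ) = ((b + α * σ : ℝ) : ℂ) + (α * t : ℝ) * I := by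
    push_cast; ring
  have k1 := h₁ (1 - σ) ⟨by linarith [hσ.2], by linarith [hσ.1]⟩ (-t)
  have k2 := h₂ (b + α * σ) ⟨by nlinarith [hσ.1], by nlinarith [hσ.2]⟩ (α * t)
  have k3 : y ^ (-σ) ≤ y ^ (-A) + y ^ (-B) := by
    have p1 := Real.rpow_pos_of_pos hy (-A)
    have p2 := Real.rpow_pos_of_pos hy (-B)
    rcases le_total 1 y with h | h
    · have := Real.rpow_le_rpow_of_exponent_le h (neg_le_neg hσ.1)
      linarith
    · have := Real.rpow_le_rpow_of_exponent_ge hy h (neg_le_neg hσ.2)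
      linarith
  rw [leRoyEntire, norm_mul, norm_mul, norm_pow, norm_cpow_eq_rpow_re_of_pos hy, e1, e2]
  have e3 : (-(σ + t * I) : ℂ).re = -σ := by simp
  rw [e3]
  rw [abs_neg] at k1
  rw [abs_mul, abs_of_pos hα] at k2
  calc _ ≤ (y ^ (-A) + y ^ (-B)) * ((C₁ * Real.exp ((Real.pi / 2 + δ / 2) * |t|)) *
        (C₂ * Real.exp ((Real.pi / 2 + δ / 2) * (α * |t|))) ^ n) := by gcongr
    _ = (y ^ (-A) + y ^ (-B)) * (C₁ * C₂ ^ n) *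
        Real.exp ((Real.pi / 2 + δ / 2) * (1 + n * α) * |t|) := by
        rw [mul_pow, ← Real.exp_nat_mul]
        have : Real.exp ((Real.pi / 2 + δ / 2) * (1 + n * α) * |t|) =
            Real.exp ((Real.pi / 2 + δ / 2) * |t|) *
              Real.exp (n * ((Real.pi / 2 + δ / 2) * (α * |t|))) := by
          rw [← Real.exp_add]; ring_nf
        rw [this]
        ring
    _ ≤ _ := by
        -- Since (π/2)(1 - nα) = 2δ, the losses (δ/2)(1 + nα) ≤ δ still leave the exponent at most π
        -- - δ.
        gcongr
        have : δ = Real.pi / 4 * (1 - n * α) := hδ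
        nlinarith

/-- This is the reflection formula. Positive integers are excluded because 1/Γ(1 - s) vanishes
there. -/
lemma leRoyEntire_mul_eq (b y : ℝ) {s : ℂ} (hs : ∀ m : ℕ, s ≠ m + 1) :
    leRoyEntire n α b y s * (Real.pi / sin (Real.pi * s)) =
      (y : ℂ) ^ (-s) * leRoyMellin n α b s := by
  have h0 : Gamma (1 - s) ≠ 0 := Gamma_ne_zero fun m hm => hs m (by linear_combination -hm)
  rw [← Gamma_mul_Gamma_one_sub, leRoyEntire, leRoyMellin]
  field_simp

lemma ne_natCast_add_one_of_re {s : ℂ} (h : ∀ m : ℤ, s.re ≠ m) (m : ℕ) : s ≠ m + 1 := by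
  rintro rfl
  exact h (m + 1) (by simp)

lemma exists_norm_cpow_mul_leRoyMellin_le (hα : 0 < α) (hnα : n * α < 1) (b A B : ℝ) {y : ℝ}
    (hy : 0 < y) :
    ∃ C, ∀ σ ∈ Icc A B, ∀ t : ℝ, 1 ≤ |t| →
      ‖(y : ℂ) ^ (-(σ + t * I)) * leRoyMellin n α b (σ + t * I)‖ ≤
        C * Real.exp (-(leRoyDecay n α * |t|)) := by
  obtain ⟨C, hC, h⟩ := exists_norm_leRoyEntire_le hα hnα b A B hy
  refine ⟨C * (4 * Real.pi), fun σ hσ t ht => ?_⟩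
  have him : (σ + t * I : ℂ).im = t := by simp
  rw [← leRoyEntire_mul_eq, norm_mul]
  · have h2 := norm_pi_div_sin_le (s := σ + t * I) (by rwa [him])
    rw [him] at h2
    calc _ ≤ C * Real.exp ((Real.pi - leRoyDecay n α) * |t|) *
          (4 * Real.pi * Real.exp (-(Real.pi * |t|))) := by
          gcongr
          exact h σ hσ t
      _ = C * (4 * Real.pi) * (Real.exp ((Real.pi - leRoyDecay n α) * |t|) *
          Real.exp (-(Real.pi * |t|))) := by ring
      _ = _ := by rw [← Real.exp_add]; ring_nf
  · intro m hm
    have := congrArg im hm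
    simp at this
    rw [this] at ht
    norm_num at ht

lemma differentiableOn_cpow_mul_leRoyMellin (n : ℕ) (α b : ℝ) {y : ℝ} (hy : 0 < y) :
    DifferentiableOn ℂ (fun s => (y : ℂ) ^ (-s) * leRoyMellin n α b s) {s | 0 < s.re} := by
  have hy0 : (y : ℂ) ≠ 0 := ofReal_ne_zero.mpr hy.ne'
  intro s hs
  refine DifferentiableAt.differentiableWithinAt ?_
  have h3 : Differentiable ℂ fun s : ℂ => (Gamma (b + α * s))⁻¹ :=
    differentiable_one_div_Gamma.comp (f := fun s : ℂ => (b : ℂ) + α * s) (by fun_prop)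
  refine ((differentiableAt_id.neg).const_cpow (Or.inl hy0)).mul
    (DifferentiableAt.mul (differentiableAt_Gamma s fun m hm => ?_) ((h3 s).pow n))
  have h : 0 < s.re := hs
  rw [hm, neg_re, natCast_re] at h
  have : (0 : ℝ) ≤ m := by positivity
  linarith

lemma continuous_vertical_leRoyMellin (n : ℕ) (α b : ℝ) {y c : ℝ} (hy : 0 < y) (hc : 0 < c) :
    Continuous fun t : ℝ => (y : ℂ) ^ (-(c + t * I) : ℂ) * leRoyMellin n α b (c + t * I) :=
  continuous_comp_vertical_line (differentiableOn_cpow_mul_leRoyMellin n α b hy).continuousOn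
    fun t => by simpa using hc

lemma integrable_vertical_leRoyMellin (hα : 0 < α) (hnα : n * α < 1) (b : ℝ) {y c : ℝ}
    (hy : 0 < y) (hc : 0 < c) :
    Integrable fun t : ℝ => (y : ℂ) ^ (-(c + t * I) : ℂ) * leRoyMellin n α b (c + t * I) := by
  obtain ⟨C, hC⟩ := exists_norm_cpow_mul_leRoyMellin_le hα hnα b c c hy
  exact integrable_of_continuous_of_norm_le_exp (continuous_vertical_leRoyMellin n α b hy hc)
    (leRoyDecay_pos hnα) (hC c ⟨le_rfl, le_rfl⟩)

lemma mellinInv_leRoyMellin_eq (hα : 0 < α) (hnα : n * α < 1) (b : ℝ) {y c c' : ℝ}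
    (hy : 0 < y) (hc : 0 < c) (hc' : 0 < c') :
    mellinInv c (leRoyMellin n α b) y = mellinInv c' (leRoyMellin n α b) y := by
  wlog hcc : c ≤ c' generalizing c c'
  · exact (this hc' hc (le_of_not_ge hcc)).symm
  obtain ⟨C, hC⟩ := exists_norm_cpow_mul_leRoyMellin_le hα hnα b c c' hy
  have h := integral_vertical_eq hcc ((differentiableOn_cpow_mul_leRoyMellin n α b hy).mono
    fun s hs => hc.trans_le hs.1) (leRoyDecay_pos hnα) hC
  simp only [mellinInv, smul_eq_mul]
  rw [h]

/-- The coefficients of the power series of the weight function. -/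
noncomputable def leRoyTaylor (n : ℕ) (α b : ℝ) (r : ℕ) : ℝ :=
  (-1) ^ r / ((r.factorial : ℝ) * Real.Gamma (b - α * r) ^ n)

lemma leRoyEntire_neg_natCast (b y : ℝ) (r : ℕ) :
    (-1) ^ r * leRoyEntire n α b y (-(r : ℂ)) = ((leRoyTaylor n α b r * y ^ r : ℝ) : ℂ) := by
  have e : (b + α * -(r : ℂ) : ℂ) = ((b - α * r : ℝ) : ℂ) := by push_cast; ring
  rw [leRoyEntire, e, Gamma_ofReal, neg_neg, cpow_natCast, sub_neg_eq_add, add_comm,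
    Gamma_nat_eq_factorial, leRoyTaylor]
  push_cast
  ring

/-- Crossing the single pole at -r. Translation by r moves it to 0, and the antiperiodicity of sin
produces the sign (-1)^r. -/
lemma mellinInv_leRoyMellin_shift (hα : 0 < α) (hnα : n * α < 1) (b : ℝ) {y : ℝ} (hy : 0 < y)
    (r : ℕ) :
    mellinInv (1 / 2 - r) (leRoyMellin n α b) y =
      ((leRoyTaylor n α b r * y ^ r : ℝ) : ℂ) +
        mellinInv (1 / 2 - (r + 1 : ℕ)) (leRoyMellin n α b) y := by
  have hδ := leRoyDecay_pos hnα
  have hδ' := leRoyDecay_le (n := n) hα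
  obtain ⟨C, hC0, hC⟩ := exists_norm_leRoyEntire_le hα hnα b (-(1 / 2) - r) (1 / 2 - r) hy
  have hres := integral_vertical_sub_of_sin_pole
    (g := fun s => (-1) ^ r * leRoyEntire n α b y (s - r))
    (((differentiable_leRoyEntire n α b hy).comp (by fun_prop)).const_mul _) hδ
    (by linarith [Real.pi_pos]) (C := C) fun σ hσ t _ => by
      have h := hC (σ - r) ⟨by linarith [hσ.1], by linarith [hσ.2]⟩ t
      have e : (σ + t * I - r : ℂ) = ((σ - r : ℝ) : ℂ) + t * I := by push_cast; ring
      simpa [e] using h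
  have hline : ∀ σ : ℝ, (∀ m : ℤ, σ - r ≠ m) → ∀ t : ℝ,
      (-1) ^ r * leRoyEntire n α b y (σ + t * I - r) * (Real.pi / sin (Real.pi * (σ + t * I))) =
      (y : ℂ) ^ (-(((σ - r : ℝ) : ℂ) + t * I)) * leRoyMellin n α b (((σ - r : ℝ) : ℂ) + t * I) := by
    intro σ hσ t
    have e : (((σ - r : ℝ) : ℂ) + t * I) = σ + t * I - r := by push_cast; ring
    have hre : (((σ - r : ℝ) : ℂ) + t * I).re = σ - r := by simp
    rw [← leRoyEntire_mul_eq b y (ne_natCast_add_one_of_re (by rw [hre]; exact hσ)), e, mul_sub,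
      mul_comm (Real.pi : ℂ) (r : ℂ), sin_antiperiodic.sub_nat_mul_eq]
    rcases neg_one_pow_eq_or ℂ r with h | h <;> rw [h]
    · simp
    · rw [neg_one_mul, neg_one_mul, div_neg, neg_mul, mul_neg]
  have hhalf : ∀ m : ℤ, (1 / 2 : ℝ) ≠ m := by
    intro m hm
    have : (1 : ℝ) = ((2 * m : ℤ) : ℝ) := by push_cast; linarith
    have : (1 : ℤ) = 2 * m := by exact_mod_cast this
    omega
  have h1 : ∀ m : ℤ, (1 / 2 : ℝ) - r ≠ m := fun m hm =>
    hhalf (m + r) (by push_cast; linarith)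
  have h2 : ∀ m : ℤ, (-(1 / 2) : ℝ) - r ≠ m := fun m hm =>
    hhalf (m + r + 1) (by push_cast; linarith)
  simp_rw [hline _ h1, hline _ h2] at hres
  rw [zero_sub, leRoyEntire_neg_natCast] at hres
  have e4 : (-(1 / 2) : ℝ) - r = 1 / 2 - (r + 1 : ℕ) := by push_cast; ring
  rw [e4] at hres
  have hpi : (Real.pi : ℂ) ≠ 0 := ofReal_ne_zero.mpr Real.pi_ne_zero
  simp only [mellinInv, smul_eq_mul, real_smul]
  rw [← sub_eq_iff_eq_add, ← mul_sub, hres]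
  push_cast
  field_simp

lemma mellinInv_leRoyMellin_eq_sum_add (hα : 0 < α) (hnα : n * α < 1) (b : ℝ) {y : ℝ}
    (hy : 0 < y) (N : ℕ) :
    mellinInv (1 / 2) (leRoyMellin n α b) y =
      (∑ r ∈ Finset.range N, ((leRoyTaylor n α b r * y ^ r : ℝ) : ℂ)) +
        mellinInv (1 / 2 - N) (leRoyMellin n α b) y := by
  induction N with
  | zero => simp
  | succ N ih =>
    rw [ih, mellinInv_leRoyMellin_shift hα hnα b hy, Finset.sum_range_succ, add_assoc]

/-- By reflection, 1/|Γ(b - αr)| ≤ Γ(1 - b + αr)/π for large r, and r! dominates the n-th power of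
this because nα < 1. -/
lemma summable_leRoyTaylor (hα : 0 < α) (hnα : n * α < 1) (b R : ℝ) :
    Summable fun r : ℕ => ‖leRoyTaylor n α b r‖ * R ^ r := by
  have hpi := Real.pi_pos
  refine Summable.of_norm_bounded_eventually_nat
    ((Real.summable_Gamma_pow_mul_pow_div_Gamma hα hnα (1 - b) 1 |R|).mul_left ((Real.pi ^ n)⁻¹)) ?_
  filter_upwards [Real.eventually_one_le_add_mul hα (1 - b)] with r hr
  have h1 := norm_inv_Gamma_le_of_re_lt_one (z := ((b - α * r : ℝ) : ℂ))
    (by rw [ofReal_re]; linarith)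
  have e : (1 - ((b - α * r : ℝ) : ℂ)) = ((1 - b + α * r : ℝ) : ℂ) := by push_cast; ring
  have hG : 0 < Real.Gamma (1 - b + α * r) := Real.Gamma_pos_of_pos (by linarith)
  rw [e, Gamma_ofReal, Gamma_ofReal, ← ofReal_inv, norm_real, norm_real, ofReal_im, abs_zero,
    mul_zero, Real.exp_zero, one_mul, Real.norm_of_nonneg hG.le] at h1
  rw [norm_mul, norm_norm, norm_pow, Real.norm_eq_abs R, leRoyTaylor, norm_div, norm_pow, norm_neg,
    norm_one, one_pow, norm_mul, norm_pow, Real.norm_natCast, one_div, mul_inv, ← inv_pow,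
    ← norm_inv, add_comm (1 : ℝ) (r : ℝ), Real.Gamma_nat_eq_factorial]
  calc _ ≤ (r.factorial : ℝ)⁻¹ * (Real.Gamma (1 - b + α * r) / Real.pi) ^ n * |R| ^ r := by gcongr
    _ = _ := by rw [div_pow]; ring

/-- Both Gamma factors are reflected to the right half-plane. Rotating Euler's integral by π/2 - δ,
where cos(π/2 - δ) = sin δ, costs only a factor geometric in N and keeps a decay rate independent of
N. -/
lemma norm_leRoyMellin_left_le (hα : 0 < α) (hnα : n * α < 1) (b : ℝ) {N : ℕ}
    (hN : 1 ≤ N) (hNb : 1 ≤ 1 - b - α / 2 + α * N) (t : ℝ) :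
    ‖leRoyMellin n α b (((1 / 2 - N : ℝ) : ℂ) + t * I)‖ ≤
      2 * Real.pi * (Real.Gamma (1 / 2 + N))⁻¹ *
        (Real.Gamma (1 - b - α / 2 + α * N) /
          Real.sin (leRoyDecay n α) ^ (1 - b - α / 2 + α * N)) ^ n *
        Real.exp (-(leRoyDecay n α * |t|)) := by
  have hpi := Real.pi_pos
  set δ := leRoyDecay n α with hδ
  have hδ0 : 0 < δ := leRoyDecay_pos hnα
  have hδ' : δ ≤ Real.pi / 4 := leRoyDecay_le hα
  set x := 1 - b - α / 2 + α * N with hx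
  set s : ℂ := ((1 / 2 - N : ℝ) : ℂ) + t * I with hs
  have hN' : (1 : ℝ) ≤ N := by exact_mod_cast hN
  have hs1 : (1 - s : ℂ) = ((1 / 2 + N : ℝ) : ℂ) + (-t : ℝ) * I := by rw [hs]; push_cast; ring
  have h1 := norm_inv_Gamma_le (x := 1 / 2 + N) (by linarith) (-t)
  rw [abs_neg] at h1
  have hG : Gamma s = Real.pi / sin (Real.pi * s) * (Gamma (1 - s))⁻¹ := by
    rw [← Gamma_mul_Gamma_one_sub, mul_inv_cancel_right₀]
    refine Gamma_ne_zero_of_re_pos ?_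
    rw [hs1]
    simp
    positivity
  have hsin : ‖Real.pi / sin (Real.pi * s)‖ ≤ 2 * Real.pi * Real.exp (-(Real.pi * |t|)) := by
    have e : Real.pi * s = Real.pi * (((1 / 2 : ℝ) : ℂ) + t * I) - N * Real.pi := by
      rw [hs]; push_cast; ring
    rw [e, sin_antiperiodic.sub_nat_mul_eq, sin_pi_mul_half_add, norm_div, norm_mul, norm_pow,
      norm_neg, norm_one, one_pow, one_mul, norm_real, norm_real, Real.norm_of_nonneg hpi.le,
      Real.norm_of_nonneg (Real.cosh_pos _).le]
    have hc : Real.exp (Real.pi * |t|) / 2 ≤ Real.cosh (Real.pi * t) := by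
      rw [← Real.cosh_abs, abs_mul, abs_of_pos hpi, Real.cosh_eq]
      have := Real.exp_pos (-(Real.pi * |t|))
      linarith
    calc _ ≤ Real.pi / (Real.exp (Real.pi * |t|) / 2) := by gcongr
      _ = _ := by rw [Real.exp_neg]; field_simp
  have e2 : (b + α * s : ℂ) = ((1 - x : ℝ) : ℂ) + (α * t : ℝ) * I := by
    rw [hs, hx]; push_cast; ring
  have h2 := norm_inv_Gamma_le_of_re_lt_one (z := b + α * s) (by rw [e2]; simp; linarith)
  have e3 : (1 - (b + α * s) : ℂ) = (x : ℂ) + (-(α * t) : ℝ) * I := by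
    rw [e2]; push_cast; ring
  have e4 : (b + α * s : ℂ).im = α * t := by rw [e2]; simp
  have h3 := norm_Gamma_le (x := x) (θ := Real.pi / 2 - δ) (by linarith) (by linarith)
    (by linarith) (-(α * t))
  rw [Real.cos_pi_div_two_sub, abs_neg, abs_mul, abs_of_pos hα] at h3
  rw [e3, e4, abs_mul, abs_of_pos hα] at h2
  have hsδ : 0 < Real.sin δ := Real.sin_pos_of_pos_of_lt_pi hδ0 (by linarith)
  have hGx : 0 < Real.Gamma x := Real.Gamma_pos_of_pos (by linarith)
  have hGN : 0 < Real.Gamma (1 / 2 + N) := Real.Gamma_pos_of_pos (by linarith)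
  have h4 : ‖(Gamma (b + α * s))⁻¹‖ ≤ Real.Gamma x / Real.sin δ ^ x *
      Real.exp ((Real.pi / 2 + δ) * (α * |t|)) := by
    calc _ ≤ _ := h2
      _ ≤ Real.exp (Real.pi * (α * |t|)) * (Real.Gamma x / Real.sin δ ^ x *
          Real.exp (-((Real.pi / 2 - δ) * (α * |t|)))) / 1 := by
          gcongr
          linarith [Real.pi_gt_three]
      _ = Real.Gamma x / Real.sin δ ^ x * (Real.exp (Real.pi * (α * |t|)) *
          Real.exp (-((Real.pi / 2 - δ) * (α * |t|)))) := by ring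
      _ = _ := by rw [← Real.exp_add]; ring_nf
  rw [leRoyMellin, norm_mul, norm_pow, hG, norm_mul, hs1]
  calc _ ≤ (2 * Real.pi * Real.exp (-(Real.pi * |t|))) *
        ((Real.Gamma (1 / 2 + N))⁻¹ * Real.exp (Real.pi / 2 * |t|)) *
        (Real.Gamma x / Real.sin δ ^ x * Real.exp ((Real.pi / 2 + δ) * (α * |t|))) ^ n := by
        gcongr
    _ = 2 * Real.pi * (Real.Gamma (1 / 2 + N))⁻¹ * (Real.Gamma x / Real.sin δ ^ x) ^ n *
        Real.exp (-((Real.pi / 2 - n * α * (Real.pi / 2 + δ)) * |t|)) := by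
        have : Real.exp (-((Real.pi / 2 - n * α * (Real.pi / 2 + δ)) * |t|)) =
            Real.exp (-(Real.pi * |t|)) * Real.exp (Real.pi / 2 * |t|) *
              Real.exp (n * ((Real.pi / 2 + δ) * (α * |t|))) := by
          rw [← Real.exp_add, ← Real.exp_add]; ring_nf
        rw [this, mul_pow, ← Real.exp_nat_mul]
        ring
    _ ≤ _ := by
        gcongr
        -- The available rate is π/2 - nα(π/2 + δ) = 2δ - nαδ, which exceeds δ.
        have : δ = Real.pi / 4 * (1 - n * α) := hδ
        nlinarith

lemma norm_mellinInv_le_of_norm_le {φ : ℂ → ℂ} {c y K δ : ℝ} (hy : 0 < y) (hδ : 0 < δ)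
    (h : ∀ t : ℝ, ‖φ (c + t * I)‖ ≤ K * Real.exp (-(δ * |t|))) :
    ‖mellinInv c φ y‖ ≤ y ^ (-c) * K * ∫ t : ℝ, Real.exp (-(δ * |t|)) := by
  have hint := integrable_exp_neg_mul_abs hδ
  have h1 : ‖∫ t : ℝ, (y : ℂ) ^ (-(c + t * I) : ℂ) • φ (c + t * I)‖ ≤
      ∫ t : ℝ, y ^ (-c) * K * Real.exp (-(δ * |t|)) := by
    refine norm_integral_le_of_norm_le (hint.const_mul _) (Eventually.of_forall fun t => ?_)
    rw [norm_smul, norm_cpow_eq_rpow_re_of_pos hy, mul_assoc]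
    have e : (-(c + t * I) : ℂ).re = -c := by simp
    rw [e]
    gcongr
    exact h t
  rw [integral_const_mul] at h1
  rw [mellinInv, norm_smul, Real.norm_of_nonneg (by positivity)]
  refine le_trans (mul_le_of_le_one_left (norm_nonneg _) ?_) h1
  rw [div_le_one (by positivity)]
  linarith [Real.pi_gt_three]

/-- Up to a constant, the bound on the N-th remainder is the N-th term of a convergent series. -/
lemma tendsto_mellinInv_leRoyMellin_left (hα : 0 < α) (hnα : n * α < 1) (b : ℝ) {y : ℝ}
    (hy : 0 < y) :
    Tendsto (fun N : ℕ => mellinInv (1 / 2 - N) (leRoyMellin n α b) y) atTop (𝓝 0) := by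
  have hpi := Real.pi_pos
  have hδ0 : 0 < leRoyDecay n α := leRoyDecay_pos hnα
  have hδ' : leRoyDecay n α ≤ Real.pi / 4 := leRoyDecay_le hα
  set S := Real.sin (leRoyDecay n α) with hS
  have hS0 : 0 < S := Real.sin_pos_of_pos_of_lt_pi hδ0 (by linarith)
  have hsum := Real.summable_Gamma_pow_mul_pow_div_Gamma hα hnα (1 - b - α / 2) (1 / 2)
    (y * ((S ^ α) ^ n)⁻¹)
  set J := ∫ t : ℝ, Real.exp (-(leRoyDecay n α * |t|)) with hJ
  have hlim := (hsum.tendsto_atTop_zero).const_mul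
    (y ^ (-(1 / 2 : ℝ)) * (2 * Real.pi) * ((S ^ (1 - b - α / 2)) ^ n)⁻¹ * J)
  rw [mul_zero] at hlim
  refine squeeze_zero_norm' ?_ hlim
  filter_upwards [eventually_ge_atTop 1, Real.eventually_one_le_add_mul hα (1 - b - α / 2)]
    with N hN hNb
  refine (norm_mellinInv_le_of_norm_le hy hδ0
    (norm_leRoyMellin_left_le hα hnα b hN hNb)).trans (le_of_eq ?_)
  have e1 : y ^ (-(1 / 2 - N : ℝ)) = y ^ (-(1 / 2 : ℝ)) * y ^ N := by
    rw [neg_sub, sub_eq_neg_add, Real.rpow_add hy, Real.rpow_natCast]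
  have e2 : S ^ (1 - b - α / 2 + α * N) = S ^ (1 - b - α / 2) * (S ^ α) ^ N := by
    rw [Real.rpow_add hS0, Real.rpow_mul hS0.le, Real.rpow_natCast]
  rw [e1, ← hJ, ← hS, e2, mul_pow, inv_pow, ← pow_mul, div_pow, mul_pow, ← pow_mul, mul_comm N n]
  field_simp

/-- The inverse Mellin transform of `Γ(s) / Γ(b + α s) ^ n` as a power series. -/
lemma hasSum_mellinInv_leRoyMellin (hα : 0 < α) (hnα : n * α < 1) (b : ℝ) {y c : ℝ}
    (hy : 0 < y) (hc : 0 < c) :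
    HasSum (fun r : ℕ => ((leRoyTaylor n α b r * y ^ r : ℝ) : ℂ))
      (mellinInv c (leRoyMellin n α b) y) := by
  rw [mellinInv_leRoyMellin_eq hα hnα b hy hc (one_half_pos)]
  have hs : Summable fun r : ℕ => ((leRoyTaylor n α b r * y ^ r : ℝ) : ℂ) := by
    refine Summable.of_norm ((summable_leRoyTaylor hα hnα b y).congr fun r => ?_)
    rw [norm_real, norm_mul, norm_pow, Real.norm_of_nonneg hy.le]
  rw [hs.hasSum_iff_tendsto_nat]
  have h := (tendsto_mellinInv_leRoyMellin_left hα hnα b hy).const_sub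
    (mellinInv (1 / 2) (leRoyMellin n α b) y)
  rw [sub_zero] at h
  refine h.congr fun N => ?_
  rw [mellinInv_leRoyMellin_eq_sum_add hα hnα b hy N, add_sub_cancel_right]

end

end

/-! ### Mellin inversion, rapid decay, moments and the Laplace transform. -/

section

open Filter Topology MeasureTheory Set Complex
open scoped FourierTransform

/-- The Mellin transform of an inverse Mellin transform. -/
lemma mellin_mellinInv_eq {φ : ℂ → ℂ} {σ : ℝ} (hc : Continuous fun t : ℝ => φ (σ + t * I))
    (hi : Complex.VerticalIntegrable φ σ) (hm : MellinConvergent (mellinInv σ φ) σ) :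
    mellin (mellinInv σ φ) σ = φ σ := by
  have h2π : 2 * Real.pi ≠ 0 := by positivity
  set G : ℝ → ℂ := fun y => φ (σ + 2 * Real.pi * y * I) with hG
  have hG' : G = fun y => (fun t : ℝ => φ (σ + t * I)) (2 * Real.pi * y) := by
    ext y; simp [hG]
  have hGc : Continuous G := by rw [hG']; exact hc.comp (by fun_prop)
  have hGi : Integrable G := by rw [hG']; exact Integrable.comp_mul_left' hi h2π
  -- With y = e^(-u) the inverse Mellin transform becomes an inverse Fourier transform, and the
  -- claim reduces to Fourier inversion for G.
  have hinv : ∀ u : ℝ, Real.exp (-σ * u) • mellinInv σ φ (Real.exp (-u)) = 𝓕⁻ G u := by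
    intro u
    rw [mellinInv_eq_fourierInv _ _ (Real.exp_pos _), Real.log_exp, neg_neg,
      ← ofReal_neg, ← ofReal_cpow (Real.exp_pos _).le, ← Real.exp_mul, real_smul, smul_eq_mul,
      ← mul_assoc, ← ofReal_mul, ← Real.exp_add,
      show -σ * u + -u * -σ = 0 by ring, Real.exp_zero, ofReal_one, one_mul]
  have hFi : Integrable (𝓕⁻ G) := by
    have himg : (fun u : ℝ => Real.exp u) '' univ = Ioi 0 := by
      rw [image_univ]; exact Real.range_exp
    rw [MellinConvergent, ← himg, integrableOn_image_iff_integrableOn_abs_deriv_smul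
      MeasurableSet.univ (fun x _ => (Real.hasDerivAt_exp x).hasDerivWithinAt)
      Real.exp_injective.injOn, integrableOn_univ] at hm
    refine hm.comp_neg.congr (Eventually.of_forall fun u => ?_)
    simp only
    rw [← hinv, Real.abs_exp, ← ofReal_one, ← ofReal_sub, ← ofReal_cpow (Real.exp_pos _).le,
      ← Real.exp_mul, real_smul, smul_eq_mul, real_smul, ← mul_assoc, ← ofReal_mul, ← Real.exp_add]
    ring_nf
  have hFi' : Integrable (𝓕 G) := by
    refine hFi.comp_neg.congr (Eventually.of_forall fun u => ?_)
    simp only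
    rw [Real.fourierInv_eq_fourier_neg, neg_neg]
  rw [mellin_eq_fourier]
  simp only [ofReal_re, ofReal_im, zero_div]
  simp_rw [hinv]
  rw [hGc.fourier_fourierInv_eq hGi hFi']
  simp [hG]

section

variable {n : ℕ} {α : ℝ}

/-- The inverse Mellin transform of `Γ(s) / Γ(b + α s) ^ n`. -/
noncomputable def leRoyDensity (n : ℕ) (α b y : ℝ) : ℂ := mellinInv 1 (leRoyMellin n α b) y

/-- As on the left lines, rotation by π/2 - δ costs (sin δ)^(-N). The remaining rate π/2 - δ - nαπ/2
is exactly δ. -/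
lemma norm_leRoyMellin_right_le (hα : 0 < α) (hnα : n * α < 1) (b : ℝ) {N : ℕ}
    (hN : 1 ≤ N) (hNb : 1 ≤ b + α * N) (t : ℝ) :
    ‖leRoyMellin n α b (((N : ℝ) : ℂ) + t * I)‖ ≤
      (N.factorial : ℝ) * ((Real.sin (leRoyDecay n α))⁻¹ ^ N / Real.Gamma (b + α * N) ^ n) *
        Real.exp (-(leRoyDecay n α * |t|)) := by
  have hpi := Real.pi_pos
  set δ := leRoyDecay n α with hδ
  have hδ0 : 0 < δ := leRoyDecay_pos hnα
  have hδ' : δ ≤ Real.pi / 4 := leRoyDecay_le hα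
  have hN' : (1 : ℝ) ≤ N := by exact_mod_cast hN
  have hsδ : 0 < Real.sin δ := Real.sin_pos_of_pos_of_lt_pi hδ0 (by linarith)
  have h1 := norm_Gamma_le (x := N) (θ := Real.pi / 2 - δ) (by linarith) (by linarith)
    (by linarith) t
  rw [Real.cos_pi_div_two_sub, Real.rpow_natCast] at h1
  have h2 := norm_inv_Gamma_le hNb (α * t)
  rw [abs_mul, abs_of_pos hα] at h2
  have e : (b + α * (((N : ℝ) : ℂ) + t * I) : ℂ) = ((b + α * N : ℝ) : ℂ) + (α * t : ℝ) * I := by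
    push_cast; ring
  have hfac : Real.Gamma N ≤ N.factorial := by
    obtain ⟨m, rfl⟩ := Nat.exists_eq_succ_of_ne_zero (by omega : N ≠ 0)
    rw [Nat.succ_eq_add_one, Nat.cast_add, Nat.cast_one, Real.Gamma_nat_eq_factorial]
    exact_mod_cast Nat.factorial_le (Nat.le_succ m)
  have hG : 0 < Real.Gamma (b + α * N) := Real.Gamma_pos_of_pos (by linarith)
  rw [leRoyMellin, norm_mul, norm_pow, e]
  calc _ ≤ (N.factorial / Real.sin δ ^ N * Real.exp (-((Real.pi / 2 - δ) * |t|))) *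
        ((Real.Gamma (b + α * N))⁻¹ * Real.exp (Real.pi / 2 * (α * |t|))) ^ n := by
        gcongr
        refine h1.trans ?_
        gcongr
    _ = (N.factorial : ℝ) * ((Real.sin δ)⁻¹ ^ N / Real.Gamma (b + α * N) ^ n) *
        Real.exp (-((Real.pi / 2 - δ - n * α * (Real.pi / 2)) * |t|)) := by
        have : Real.exp (-((Real.pi / 2 - δ - n * α * (Real.pi / 2)) * |t|)) =
            Real.exp (-((Real.pi / 2 - δ) * |t|)) *
              Real.exp (n * (Real.pi / 2 * (α * |t|))) := by
          rw [← Real.exp_add]; ring_nf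
        rw [this, mul_pow, ← Real.exp_nat_mul, inv_pow, inv_pow]
        field_simp
    _ ≤ _ := by
        gcongr
        have : δ = Real.pi / 4 * (1 - n * α) := hδ
        nlinarith

lemma norm_leRoyDensity_le_of_le_one (hα : 0 < α) (hnα : n * α < 1) (b : ℝ) {y : ℝ} (hy : 0 < y)
    (hy1 : y ≤ 1) : ‖leRoyDensity n α b y‖ ≤ ∑' r, ‖leRoyTaylor n α b r‖ := by
  have hs : Summable fun r => ‖leRoyTaylor n α b r‖ := by
    simpa using summable_leRoyTaylor hα hnα b 1
  rw [leRoyDensity, ← (hasSum_mellinInv_leRoyMellin hα hnα b hy one_pos).tsum_eq]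
  refine tsum_of_norm_bounded hs.hasSum fun r => ?_
  rw [norm_real, norm_mul, norm_pow, Real.norm_of_nonneg hy.le]
  exact mul_le_of_le_one_right (norm_nonneg _) (pow_le_one₀ hy.le hy1)

/-- The inverse Mellin transform decays faster than any exponential. -/
lemma exists_norm_leRoyDensity_le (hn : 0 < n) (hα : 0 < α) (hnα : n * α < 1) (b : ℝ) {X : ℝ}
    (hX : 0 ≤ X) :
    ∃ C, ∀ y : ℝ, 0 < y → ‖leRoyDensity n α b y‖ ≤ C * Real.exp (-(X * y)) := by
  have hδ0 : 0 < leRoyDecay n α := leRoyDecay_pos hnα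
  set J := ∫ t : ℝ, Real.exp (-(leRoyDecay n α * |t|)) with hJ
  set S := Real.sin (leRoyDecay n α) with hS
  set Q : ℕ → ℝ := fun N => (N.factorial : ℝ) * (S⁻¹ ^ N / Real.Gamma (b + α * N) ^ n) * J with hQ
  obtain ⟨M, hM⟩ := eventually_atTop.mp
    ((eventually_ge_atTop 1).and (Real.eventually_one_le_add_mul hα b))
  have hbound : ∀ N, M ≤ N → ∀ y : ℝ, 0 < y → y ^ N * ‖leRoyDensity n α b y‖ ≤ Q N := by
    intro N hN y hy
    obtain ⟨hN1, hNb⟩ := hM N hN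
    have h := norm_mellinInv_le_of_norm_le hy hδ0 (norm_leRoyMellin_right_le hα hnα b hN1 hNb)
    rw [leRoyDensity, mellinInv_leRoyMellin_eq hα hnα b hy one_pos
      (show (0 : ℝ) < N by exact_mod_cast hN1)]
    calc _ ≤ y ^ N * _ := mul_le_mul_of_nonneg_left h (by positivity)
      _ = _ := by
        rw [Real.rpow_neg hy.le, Real.rpow_natCast, hQ]
        field_simp
        rw [hS, hJ]
  -- The N! in Q N cancels against the exponential series and leaves the convergent Le Roy series at
  -- X/S. For N < M the bound at index M is borrowed, which is legitimate when y ≥ 1; the range y ≤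
  -- 1 is covered by the power series.
  set v : ℕ → ℝ := fun N => X ^ N / N.factorial * Q (max N M) with hv
  have hvs : Summable v := by
    refine Summable.of_norm_bounded_eventually_nat
      (((Real.summable_pow_div_Gamma_pow hn hα b (X * S⁻¹)).mul_right J).norm) ?_
    filter_upwards [eventually_ge_atTop M] with N hN
    refine le_of_eq (congrArg norm ?_)
    simp only [hv, hQ]
    rw [max_eq_left hN, mul_pow]
    have : (N.factorial : ℝ) ≠ 0 := by exact_mod_cast N.factorial_ne_zero
    field_simp
  have hlarge : ∀ y : ℝ, 1 ≤ y → Real.exp (X * y) * ‖leRoyDensity n α b y‖ ≤ ∑' N, v N := by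
    intro y hy
    have hy0 : 0 < y := by linarith
    have h1 : HasSum (fun N : ℕ => (X * y) ^ N / N.factorial * ‖leRoyDensity n α b y‖)
        (Real.exp (X * y) * ‖leRoyDensity n α b y‖) := by
      rw [Real.exp_eq_exp_ℝ]
      exact (NormedSpace.expSeries_div_hasSum_exp (X * y)).mul_right _
    refine hasSum_le (fun N => ?_) h1 hvs.hasSum
    have h2 : y ^ N * ‖leRoyDensity n α b y‖ ≤ Q (max N M) := by
      refine le_trans ?_ (hbound (max N M) (le_max_right _ _) y hy0)
      gcongr
      exact le_max_left _ _
    calc _ = X ^ N / N.factorial * (y ^ N * ‖leRoyDensity n α b y‖) := by rw [mul_pow]; ring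
      _ ≤ _ := by simp only [hv]; gcongr
  set K := ∑' r, ‖leRoyTaylor n α b r‖ with hK
  have hK0 : 0 ≤ K := tsum_nonneg fun r => norm_nonneg _
  refine ⟨max (∑' N, v N) (K * Real.exp X), fun y hy => ?_⟩
  rcases le_total y 1 with hy1 | hy1
  · calc _ ≤ K := norm_leRoyDensity_le_of_le_one hα hnα b hy hy1
      _ = K * Real.exp X * Real.exp (-X) := by rw [mul_assoc, ← Real.exp_add]; simp
      _ ≤ max (∑' N, v N) (K * Real.exp X) * Real.exp (-(X * y)) := by
        gcongr
        · exact le_max_right _ _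
        · nlinarith
  · have h := hlarge y hy1
    rw [Real.exp_neg, ← div_eq_mul_inv, le_div_iff₀ (Real.exp_pos _), mul_comm]
    exact h.trans (le_max_left _ _)

/-- On y > 0 the density is a pointwise limit of polynomials. -/
lemma aestronglyMeasurable_leRoyDensity (hα : 0 < α) (hnα : n * α < 1) (b : ℝ) :
    AEStronglyMeasurable (leRoyDensity n α b) (volume.restrict (Ioi 0)) := by
  have hs : ∀ y : ℝ, Summable fun r : ℕ => ((leRoyTaylor n α b r * y ^ r : ℝ) : ℂ) := fun y => by
    refine Summable.of_norm ((summable_leRoyTaylor hα hnα b |y|).congr fun r => ?_)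
    rw [norm_real, norm_mul, norm_pow, Real.norm_eq_abs y]
  have hm : Measurable fun y : ℝ => ∑' r : ℕ, ((leRoyTaylor n α b r * y ^ r : ℝ) : ℂ) :=
    measurable_of_tendsto_metrizable
      (f := fun N y => ∑ r ∈ Finset.range N, ((leRoyTaylor n α b r * y ^ r : ℝ) : ℂ))
      (fun N => Continuous.measurable (by fun_prop))
      (tendsto_pi_nhds.mpr fun y => (hs y).hasSum.tendsto_sum_nat)
  refine hm.aestronglyMeasurable.congr ?_
  filter_upwards [ae_restrict_mem measurableSet_Ioi] with y hy
  exact (hasSum_mellinInv_leRoyMellin hα hnα b hy one_pos).tsum_eq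

lemma integrableOn_pow_mul_exp_neg (r : ℕ) {X : ℝ} (hX : 0 < X) :
    IntegrableOn (fun y : ℝ => y ^ r * Real.exp (-(X * y))) (Ioi 0) := by
  have h := integrableOn_rpow_mul_exp_neg_mul_rpow (p := 1) (s := r) (b := X)
    (by have : (0 : ℝ) ≤ r := by positivity
        linarith) one_pos hX
  simpa using h

lemma integral_pow_mul_exp_neg (r : ℕ) {X : ℝ} (hX : 0 < X) :
    ∫ y in Ioi (0 : ℝ), y ^ r * Real.exp (-(X * y)) = r.factorial / X ^ (r + 1) := by
  have h := Real.integral_rpow_mul_exp_neg_mul_Ioi (a := r + 1) (r := X) (by positivity) hX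
  rw [Real.Gamma_nat_eq_factorial, ← Nat.cast_add_one, Real.rpow_natCast] at h
  simp only [Nat.cast_add, Nat.cast_one, add_sub_cancel_right, Real.rpow_natCast] at h
  rw [h, one_div, inv_pow]
  ring

lemma integrableOn_pow_mul_leRoyDensity (hn : 0 < n) (hα : 0 < α) (hnα : n * α < 1) (b : ℝ)
    (r : ℕ) : IntegrableOn (fun y : ℝ => (y : ℂ) ^ r * leRoyDensity n α b y) (Ioi 0) := by
  obtain ⟨C, hC⟩ := exists_norm_leRoyDensity_le hn hα hnα b zero_le_one
  refine Integrable.mono' ((integrableOn_pow_mul_exp_neg r one_pos).const_mul C)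
    (AEStronglyMeasurable.mul (Continuous.aestronglyMeasurable (by fun_prop))
      (aestronglyMeasurable_leRoyDensity hα hnα b)) ?_
  filter_upwards [ae_restrict_mem measurableSet_Ioi] with y hy
  have hy0 : (0 : ℝ) < y := hy
  rw [norm_mul, norm_pow, norm_real, Real.norm_of_nonneg hy0.le]
  calc _ ≤ y ^ r * (C * Real.exp (-(1 * y))) := by
        gcongr
        exact hC y hy0
    _ = _ := by ring

/-- The moments of the inverse Mellin transform. -/
lemma integral_pow_mul_leRoyDensity (hn : 0 < n) (hα : 0 < α) (hnα : n * α < 1) (b : ℝ)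
    (r : ℕ) : ∫ y in Ioi (0 : ℝ), (y : ℂ) ^ r * leRoyDensity n α b y =
      ((r.factorial / Real.Gamma (b + α + α * r) ^ n : ℝ) : ℂ) := by
  have hr : (0 : ℝ) < ((r + 1 : ℕ) : ℝ) := by positivity
  have e1 : ∀ y : ℝ, (y : ℂ) ^ ((((r + 1 : ℕ) : ℝ) : ℂ) - 1) = (y : ℂ) ^ r := by
    intro y
    rw [ofReal_natCast, Nat.cast_add, Nat.cast_one, add_sub_cancel_right, cpow_natCast]
  have e2 : ∀ y ∈ Ioi (0 : ℝ), leRoyDensity n α b y =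
      mellinInv ((r + 1 : ℕ) : ℝ) (leRoyMellin n α b) y := fun y hy =>
    mellinInv_leRoyMellin_eq hα hnα b hy one_pos hr
  have hm : MellinConvergent (mellinInv ((r + 1 : ℕ) : ℝ) (leRoyMellin n α b))
      (((r + 1 : ℕ) : ℝ) : ℂ) := by
    refine (integrableOn_pow_mul_leRoyDensity hn hα hnα b r).congr_fun (fun y hy => ?_)
      measurableSet_Ioi
    simp only
    rw [e1, e2 y hy, smul_eq_mul]
  have hc : Continuous fun t : ℝ => leRoyMellin n α b ((((r + 1 : ℕ) : ℝ) : ℂ) + t * I) := by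
    simpa using continuous_vertical_leRoyMellin n α b one_pos hr
  have hi : Complex.VerticalIntegrable (leRoyMellin n α b) ((r + 1 : ℕ) : ℝ) := by
    have h := integrable_vertical_leRoyMellin hα hnα b one_pos hr
    simp only [ofReal_one, one_cpow, one_mul] at h
    exact h
  have h := mellin_mellinInv_eq hc hi hm
  rw [mellin] at h
  have e3 : leRoyMellin n α b (((r + 1 : ℕ) : ℝ) : ℂ) =
      ((r.factorial / Real.Gamma (b + α + α * r) ^ n : ℝ) : ℂ) := by
    have e4 : (b + α * (((r + 1 : ℕ) : ℝ) : ℂ) : ℂ) = ((b + α + α * r : ℝ) : ℂ) := by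
      push_cast; ring
    rw [leRoyMellin, e4, Gamma_ofReal, Gamma_ofReal, Nat.cast_add, Nat.cast_one,
      Real.Gamma_nat_eq_factorial]
    push_cast
    ring
  rw [← e3, ← h]
  refine setIntegral_congr_fun measurableSet_Ioi fun y hy => ?_
  rw [e1, e2 y hy, smul_eq_mul]

/-- The Laplace transform of the inverse Mellin transform. -/
lemma integrableOn_and_integral_exp_mul_leRoyDensity (hn : 0 < n) (hα : 0 < α)
    (hnα : n * α < 1) (b x : ℝ) :
    IntegrableOn (fun y : ℝ => (Real.exp (-(x * y)) : ℂ) * leRoyDensity n α b y) (Ioi 0) ∧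
    ((∑' r : ℕ, (-x) ^ r / Real.Gamma (b + α + α * r) ^ n : ℝ) : ℂ) =
      ∫ y in Ioi (0 : ℝ), (Real.exp (-(x * y)) : ℂ) * leRoyDensity n α b y := by
  -- Decay at rate |x| + 1 beats e^(-xy), and it bounds the integrals of the terms of the expansion
  -- by a geometric series of ratio |x| / (|x| + 1).
  have hX : 0 < |x| + 1 := by positivity
  obtain ⟨C, hC⟩ := exists_norm_leRoyDensity_le hn hα hnα b hX.le
  constructor
  · refine Integrable.mono' ((integrableOn_pow_mul_exp_neg 0 one_pos).const_mul C)
      (AEStronglyMeasurable.mul (Continuous.aestronglyMeasurable (by fun_prop))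
        (aestronglyMeasurable_leRoyDensity hα hnα b)) ?_
    filter_upwards [ae_restrict_mem measurableSet_Ioi] with y hy
    have hy0 : (0 : ℝ) < y := hy
    have hC0 : 0 ≤ C := nonneg_of_mul_nonneg_left ((norm_nonneg _).trans (hC y hy0))
      (Real.exp_pos _)
    rw [norm_mul, norm_real, Real.norm_of_nonneg (Real.exp_pos _).le, pow_zero, one_mul]
    calc _ ≤ Real.exp (-(x * y)) * (C * Real.exp (-((|x| + 1) * y))) := by
          gcongr
          exact hC y hy0
      _ = C * Real.exp (-(x * y) - (|x| + 1) * y) := by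
          rw [mul_left_comm, ← Real.exp_add, sub_eq_add_neg]
      _ ≤ _ := by
          gcongr
          nlinarith [neg_abs_le x]
  · set F : ℕ → ℝ → ℂ := fun r y =>
      (((-x) ^ r / r.factorial : ℝ) : ℂ) * ((y : ℂ) ^ r * leRoyDensity n α b y) with hF
    have hFi : ∀ r, Integrable (F r) (volume.restrict (Ioi 0)) := fun r =>
      (integrableOn_pow_mul_leRoyDensity hn hα hnα b r).const_mul _
    have hFs : Summable fun r => ∫ y in Ioi (0 : ℝ), ‖F r y‖ := by
      refine Summable.of_nonneg_of_le (fun r => integral_nonneg fun y => norm_nonneg _) (fun r => ?_)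
        ((summable_geometric_of_lt_one (r := |x| / (|x| + 1)) (by positivity)
          (by rw [div_lt_one hX]; linarith)).mul_left (C / (|x| + 1)))
      calc ∫ y in Ioi (0 : ℝ), ‖F r y‖
          ≤ ∫ y in Ioi (0 : ℝ), C * (|x| ^ r / r.factorial) *
              (y ^ r * Real.exp (-((|x| + 1) * y))) := by
            refine setIntegral_mono_on (hFi r).norm
              ((integrableOn_pow_mul_exp_neg r hX).const_mul _) measurableSet_Ioi fun y hy => ?_
            have hy0 : (0 : ℝ) < y := hy
            simp only [hF]
            rw [norm_mul, norm_mul, norm_pow, norm_real, norm_real, norm_div, norm_pow, norm_neg,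
              Real.norm_natCast, Real.norm_of_nonneg hy0.le, Real.norm_eq_abs]
            calc _ ≤ |x| ^ r / r.factorial * (y ^ r * (C * Real.exp (-((|x| + 1) * y)))) := by
                  gcongr
                  exact hC y hy0
              _ = _ := by ring
        _ = C * (|x| ^ r / r.factorial) * (r.factorial / (|x| + 1) ^ (r + 1)) := by
            rw [integral_const_mul, integral_pow_mul_exp_neg r hX]
        _ = _ := by
            have : (r.factorial : ℝ) ≠ 0 := by exact_mod_cast r.factorial_ne_zero
            rw [div_pow]
            field_simp
            ring
    have h := hasSum_integral_of_summable_integral_norm hFi hFs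
    have e1 : ∀ r, ∫ y in Ioi (0 : ℝ), F r y =
        (((-x) ^ r / Real.Gamma (b + α + α * r) ^ n : ℝ) : ℂ) := by
      intro r
      simp only [hF]
      rw [integral_const_mul, integral_pow_mul_leRoyDensity hn hα hnα b r, ← ofReal_mul]
      have : (r.factorial : ℝ) ≠ 0 := by exact_mod_cast r.factorial_ne_zero
      congr 1
      field_simp
    have e2 : ∀ y : ℝ, ∑' r, F r y = (Real.exp (-(x * y)) : ℂ) * leRoyDensity n α b y := by
      intro y
      have h1 : HasSum (fun r : ℕ => (-x * y) ^ r / r.factorial) (Real.exp (-(x * y))) := by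
        rw [Real.exp_eq_exp_ℝ, ← neg_mul]
        exact NormedSpace.expSeries_div_hasSum_exp (-x * y)
      have h2 := (hasSum_ofReal.mpr h1).mul_right (leRoyDensity n α b y)
      rw [← h2.tsum_eq]
      refine tsum_congr fun r => ?_
      simp only [hF]
      push_cast
      rw [mul_pow]
      ring
    simp_rw [e1, e2] at h
    rw [← h.tsum_eq, ofReal_tsum]

end

end

/-! ### Reduction of the Meijer function to the inverse Mellin transform. -/

section

open Filter Topology MeasureTheory Set Complex

lemma gammaList_eq (k : ℕ) (u : ℂ) :
    gammaList k u = (List.range k).map fun j : ℕ => (u + j) / k := by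
  rw [gammaList]
  -- In the body of `gammaList` the index is complex, because the range itself is coerced to a list
  -- over ℂ by a `flatMap` of singletons.
  change List.map _ (List.flatMap (fun a : ℕ => [(a : ℂ)]) (List.range k)) = _
  rw [← List.map_eq_flatMap, List.map_map]
  rfl

lemma prod_map_gammaList (k : ℕ) (u : ℂ) (f : ℂ → ℂ) :
    ((gammaList k u).map f).prod = ∏ j ∈ Finset.range k, f ((u + j) / k) := by
  rw [gammaList_eq, List.map_map]
  generalize (k : ℂ) = c
  induction k with
  | zero => simp
  | succ N ih => rw [List.range_succ, Finset.prod_range_succ, ← ih]; simp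

lemma prod_Gamma_gammaList {k : ℕ} (hk : 0 < k) (u s : ℂ) :
    ((gammaList k u).map fun t => Gamma (t + s)).prod =
      (((2 * Real.pi) ^ (((k : ℝ) - 1) / 2) * √k : ℝ) : ℂ) * (k : ℂ) ^ (-(k * s + u)) *
        Gamma (k * s + u) := by
  have hk0 : (k : ℂ) ≠ 0 := by exact_mod_cast hk.ne'
  have e : (k : ℂ) * (s + u / k) = k * s + u := by field_simp
  have h := prod_Gamma_add_div hk (s + u / k)
  rw [e] at h
  rw [← h, prod_map_gammaList]
  refine Finset.prod_congr rfl fun j _ => ?_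
  congr 1
  ring

/-- With w = ks + 1, the block Γ(ls + β) is Γ(b + αw) for α = l/k and b = β - l/k. -/
lemma meijerKernel_leRoy_eq (n : ℕ) {l k : ℕ} (hl : 0 < l) (hk : 0 < k) (β : ℝ) (s : ℂ) :
    meijerKernel k 0 (upperParams n l β) (lowerParams k) s =
      (((2 * Real.pi) ^ (((k : ℝ) - 1) / 2) * √k : ℝ) : ℂ) * (k : ℂ) ^ (-(k * s + 1)) *
        ((((2 * Real.pi) ^ (((l : ℝ) - 1) / 2) * √l : ℝ) : ℂ) *
          (l : ℂ) ^ (-(l * s + β)))⁻¹ ^ n *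
        leRoyMellin n ((l : ℝ) / k) (β - (l : ℝ) / k) (k * s + 1) := by
  have hk0 : (k : ℂ) ≠ 0 := by exact_mod_cast hk.ne'
  have hlen : (lowerParams k).length = k := by simp [lowerParams, gammaList_eq]
  have e : (((β - (l : ℝ) / k : ℝ) : ℂ) + ((l : ℝ) / k : ℝ) * (k * s + 1)) = l * s + β := by
    push_cast
    field_simp
    ring
  rw [meijerKernel, List.take_of_length_le hlen.le, List.drop_of_length_le hlen.le, List.drop_zero,
    List.take_zero, upperParams, lowerParams, List.map_flatten, List.prod_flatten,
    List.map_replicate, List.map_replicate, List.prod_replicate, prod_Gamma_gammaList hk,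
    prod_Gamma_gammaList hl, leRoyMellin, e]
  simp only [List.map_nil, List.prod_nil, mul_one]
  rw [mul_pow, inv_pow, inv_pow, div_eq_mul_inv, mul_inv]
  ring

/-- The constant relating the Mellin-Barnes kernel to the Mellin transform of the weight. -/
noncomputable def leRoyConst (n l k : ℕ) (β : ℝ) : ℝ :=
  (2 * Real.pi) ^ (((k : ℝ) - 1) / 2) * √k * ((2 * Real.pi) ^ (((l : ℝ) - 1) / 2) * √l)⁻¹ ^ n *
    Real.exp (-Real.log k + n * (β * Real.log l))

/-- The argument l^(nl) y^k / k^k is made to cancel the powers of k and l from Gauss's formula. What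
remains of it is y^(-ks) = y · y^(-(ks + 1)). -/
lemma cpow_mul_meijerKernel_leRoy_eq (n : ℕ) {l k : ℕ} (hl : 0 < l) (hk : 0 < k) (β : ℝ)
    {y : ℝ} (hy : 0 < y) (s : ℂ) :
    (((l : ℝ) ^ (n * l) * y ^ k / (k : ℝ) ^ k : ℝ) : ℂ) ^ (-s) *
        meijerKernel k 0 (upperParams n l β) (lowerParams k) s =
      ((leRoyConst n l k β * y : ℝ) : ℂ) * ((y : ℂ) ^ (-(k * s + 1)) *
        leRoyMellin n ((l : ℝ) / k) (β - (l : ℝ) / k) (k * s + 1)) := by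
  have hk0 : (0 : ℝ) < k := by exact_mod_cast hk
  have hl0 : (0 : ℝ) < l := by exact_mod_cast hl
  have hz : 0 < (l : ℝ) ^ (n * l) * y ^ k / (k : ℝ) ^ k := by positivity
  have hlog : Real.log ((l : ℝ) ^ (n * l) * y ^ k / (k : ℝ) ^ k) =
      n * l * Real.log l + k * Real.log y - k * Real.log k := by
    rw [Real.log_div (by positivity) (by positivity), Real.log_mul (by positivity) (by positivity),
      Real.log_pow, Real.log_pow, Real.log_pow]
    push_cast
    ring
  have hpow : ∀ {x : ℝ}, 0 < x → ∀ w : ℂ, (x : ℂ) ^ w = cexp (Real.log x * w) := fun hx w => by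
    rw [cpow_def_of_ne_zero (ofReal_ne_zero.mpr hx.ne'), ofReal_log hx.le]
  have key : (((l : ℝ) ^ (n * l) * y ^ k / (k : ℝ) ^ k : ℝ) : ℂ) ^ (-s) *
      ((k : ℂ) ^ (-(k * s + 1)) * ((l : ℂ) ^ (-(l * s + β)))⁻¹ ^ n) =
      cexp (-Real.log k + n * (β * Real.log l)) * (y * (y : ℂ) ^ (-(k * s + 1))) := by
    have h1 : (y : ℂ) = cexp (Real.log y * 1) := by rw [← hpow hy, cpow_one]
    rw [← ofReal_natCast k, ← ofReal_natCast l, hpow hz, hpow hk0, hpow hl0, hpow hy, hlog]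
    rw [h1]
    rw [← Complex.exp_neg, ← Complex.exp_nat_mul, ← Complex.exp_add, ← Complex.exp_add,
      ← Complex.exp_add, ← Complex.exp_add]
    congr 1
    push_cast
    ring
  rw [meijerKernel_leRoy_eq n hl hk β s, leRoyConst, mul_inv, mul_pow]
  calc _ = (((2 * Real.pi) ^ (((k : ℝ) - 1) / 2) * √k : ℝ) : ℂ) *
        (((2 * Real.pi) ^ (((l : ℝ) - 1) / 2) * √l : ℝ) : ℂ)⁻¹ ^ n *
        ((((l : ℝ) ^ (n * l) * y ^ k / (k : ℝ) ^ k : ℝ) : ℂ) ^ (-s) *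
          ((k : ℂ) ^ (-(k * s + 1)) * ((l : ℂ) ^ (-(l * s + β)))⁻¹ ^ n)) *
        leRoyMellin n ((l : ℝ) / k) (β - (l : ℝ) / k) (k * s + 1) := by ring
    _ = _ := by
      rw [key]
      push_cast
      ring

lemma natCast_mul_vertical (k : ℕ) (c t : ℝ) :
    ((k : ℂ) * (c + t * I) + 1) = ((k * c + 1 : ℝ) : ℂ) + (k * t : ℝ) * I := by
  push_cast; ring

/-- The change of variable w = ks + 1 has Jacobian 1/k and sends Re s = c to Re w = kc + 1. The
right side does not involve c, which gives independence of the line. -/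
lemma mellinInv_meijerKernel_leRoy_eq {n l k : ℕ} (hl : 0 < l) (hk : 0 < k)
    (hnα : n * ((l : ℝ) / k) < 1) (β : ℝ) {c y : ℝ} (hc : 0 < k * c + 1) (hy : 0 < y) :
    mellinInv c (meijerKernel k 0 (upperParams n l β) (lowerParams k))
        ((l : ℝ) ^ (n * l) * y ^ k / (k : ℝ) ^ k) =
      ((leRoyConst n l k β * y * (k : ℝ)⁻¹ : ℝ) : ℂ) *
        leRoyDensity n ((l : ℝ) / k) (β - (l : ℝ) / k) y := by
  have hk0 : (0 : ℝ) < k := by exact_mod_cast hk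
  rw [leRoyDensity, mellinInv_leRoyMellin_eq (by positivity) hnα _ hy one_pos hc]
  simp only [mellinInv, smul_eq_mul, real_smul]
  simp_rw [cpow_mul_meijerKernel_leRoy_eq n hl hk β hy, natCast_mul_vertical]
  rw [integral_const_mul, Measure.integral_comp_mul_left
    (fun t : ℝ => (y : ℂ) ^ (-(((k * c + 1 : ℝ) : ℂ) + t * I)) *
      leRoyMellin n ((l : ℝ) / k) (β - (l : ℝ) / k) (((k * c + 1 : ℝ) : ℂ) + t * I)) (k : ℝ),
    abs_of_pos (inv_pos.mpr hk0), real_smul]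
  push_cast
  ring

lemma exists_pos_eq_mul_pow_div (n : ℕ) {l k : ℕ} (hl : 0 < l) (hk : 0 < k) {z : ℝ} (hz : 0 < z) :
    ∃ y : ℝ, 0 < y ∧ z = (l : ℝ) ^ (n * l) * y ^ k / (k : ℝ) ^ k := by
  have hk0 : (0 : ℝ) < k := by exact_mod_cast hk
  have hl0 : (0 : ℝ) < l := by exact_mod_cast hl
  refine ⟨(z * (k : ℝ) ^ k / (l : ℝ) ^ (n * l)) ^ ((k : ℝ)⁻¹), by positivity, ?_⟩
  rw [Real.rpow_inv_natCast_pow (by positivity) hk.ne']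
  field_simp

lemma separatesPoles_zero (n l : ℕ) {k : ℕ} (hk : 0 < k) (β : ℝ) :
    SeparatesPoles k 0 (upperParams n l β) (lowerParams k) 0 := by
  have hk0 : (0 : ℝ) < k := by exact_mod_cast hk
  refine ⟨fun t ht => ?_, by simp⟩
  rw [lowerParams, gammaList_eq] at ht
  obtain ⟨j, -, rfl⟩ := List.mem_map.mp (List.mem_of_mem_take ht)
  have e : (((1 : ℂ) + j) / k) = (((1 + j) / k : ℝ) : ℂ) := by push_cast; rfl
  rw [e, ofReal_re, neg_lt_zero]
  positivity

lemma SeparatesPoles.pos {n l k : ℕ} (hk : 0 < k) {β c : ℝ}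
    (h : SeparatesPoles k 0 (upperParams n l β) (lowerParams k) c) : 0 < k * c + 1 := by
  have hk0 : (0 : ℝ) < k := by exact_mod_cast hk
  -- The smallest lower parameter 1/k already forces c > -1/k.
  have hmem : (((1 : ℝ) / k : ℝ) : ℂ) ∈ (lowerParams k).take k := by
    rw [lowerParams, gammaList_eq, List.take_of_length_le (by simp)]
    refine List.mem_map.mpr ⟨0, by simpa using hk, by simp⟩
  have := h.1 _ hmem
  rw [ofReal_re] at this
  have h2 : k * (-(1 / k)) < k * c := mul_lt_mul_of_pos_left this hk0
  rw [mul_neg, mul_one_div_cancel hk0.ne'] at h2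
  linarith

lemma verticalIntegrable_meijerKernel {n l k : ℕ} (hl : 0 < l) (hk : 0 < k)
    (hnα : n * ((l : ℝ) / k) < 1) (β : ℝ) {c : ℝ}
    (hc : SeparatesPoles k 0 (upperParams n l β) (lowerParams k) c) :
    Complex.VerticalIntegrable (meijerKernel k 0 (upperParams n l β) (lowerParams k)) c := by
  have hk0 : (0 : ℝ) < k := by exact_mod_cast hk
  -- At argument 1 the power z^(-s) is 1, so only the bare kernel is left.
  obtain ⟨y, hy, h1⟩ := exists_pos_eq_mul_pow_div n hl hk one_pos
  have h := ((integrable_vertical_leRoyMellin (by positivity) hnα (β - (l : ℝ) / k) hy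
    (hc.pos hk)).comp_mul_left' hk0.ne').const_mul ((leRoyConst n l k β * y : ℝ) : ℂ)
  refine h.congr (Eventually.of_forall fun t => ?_)
  have e := cpow_mul_meijerKernel_leRoy_eq n hl hk β hy (c + t * I)
  rw [← h1, ofReal_one, one_cpow, one_mul, natCast_mul_vertical] at e
  exact e.symm

lemma mellinInv_meijerKernel_eq_meijerG {n l k : ℕ} (hl : 0 < l) (hk : 0 < k)
    (hnα : n * ((l : ℝ) / k) < 1) (β : ℝ) {c z : ℝ}
    (hc : SeparatesPoles k 0 (upperParams n l β) (lowerParams k) c) (hz : 0 < z) :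
    mellinInv c (meijerKernel k 0 (upperParams n l β) (lowerParams k)) z =
      meijerG k 0 (upperParams n l β) (lowerParams k) z := by
  obtain ⟨y, hy, rfl⟩ := exists_pos_eq_mul_pow_div n hl hk hz
  -- The line picked by `Classical.epsilon` in `meijerG` is admissible because c is.
  have hε := Classical.epsilon_spec
    (p := fun c : ℝ => SeparatesPoles k 0 (upperParams n l β) (lowerParams k) c) ⟨c, hc⟩
  rw [meijerG, mellinInv_meijerKernel_leRoy_eq hl hk hnα β (hc.pos hk) hy,
    mellinInv_meijerKernel_leRoy_eq hl hk hnα β (SeparatesPoles.pos hk hε) hy]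

lemma leRoyWeight_prefactor (n : ℕ) {l k : ℕ} (hl : 0 < l) (hk : 0 < k) (β : ℝ) {y : ℝ}
    (hy : 0 < y) :
    ((2 * Real.pi) ^ ((1 - (k : ℝ)) / 2 - (n : ℝ) * (1 - (l : ℝ)) / 2) * (k : ℝ) ^ (3 / 2 : ℝ) *
      (l : ℝ) ^ (-((n : ℝ) * (β - 1 / 2))) * y⁻¹) * (leRoyConst n l k β * y * (k : ℝ)⁻¹) = 1 := by
  have hk0 : (0 : ℝ) < k := by exact_mod_cast hk
  have hl0 : (0 : ℝ) < l := by exact_mod_cast hl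
  have hp0 : 0 < 2 * Real.pi := by positivity
  have hinv : (k : ℝ)⁻¹ = Real.exp (-Real.log k) := by rw [Real.exp_neg, Real.exp_log hk0]
  calc _ = (2 * Real.pi) ^ ((1 - (k : ℝ)) / 2 - (n : ℝ) * (1 - (l : ℝ)) / 2) *
        (k : ℝ) ^ (3 / 2 : ℝ) * (l : ℝ) ^ (-((n : ℝ) * (β - 1 / 2))) *
        (leRoyConst n l k β * (k : ℝ)⁻¹) := by field_simp
    _ = 1 := by
      rw [leRoyConst, Real.sqrt_eq_rpow, Real.sqrt_eq_rpow, hinv]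
      simp only [Real.rpow_def_of_pos hp0, Real.rpow_def_of_pos hk0, Real.rpow_def_of_pos hl0,
        ← Real.exp_add, ← Real.exp_neg, ← Real.exp_nat_mul]
      rw [Real.exp_eq_one_iff]
      ring

lemma leRoyWeight_eq_leRoyDensity {n l k : ℕ} (hl : 0 < l) (hk : 0 < k)
    (hnα : n * ((l : ℝ) / k) < 1) (β : ℝ) {y : ℝ} (hy : 0 < y) :
    leRoyWeight n l k β y = leRoyDensity n ((l : ℝ) / k) (β - (l : ℝ) / k) y := by
  have h0 := separatesPoles_zero n l hk β
  have hk0 : (0 : ℝ) < k := by exact_mod_cast hk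
  have hl0 : (0 : ℝ) < l := by exact_mod_cast hl
  rw [leRoyWeight, ← mellinInv_meijerKernel_eq_meijerG hl hk hnα β h0 (by positivity),
    mellinInv_meijerKernel_leRoy_eq hl hk hnα β (h0.pos hk) hy, ← mul_assoc, ← ofReal_mul,
    leRoyWeight_prefactor n hl hk β hy, ofReal_one, one_mul]

end

theorem theorem1 (n l k : ℕ) (hn : 0 < n) (hl : 0 < l) (hk : 0 < k)
    (hlk : (l : ℝ) / k < 1 / n) (β : ℝ) :
    -- the Mellin-Barnes integral defining the Meijer function converges absolutely, and its value
    -- is the same on all admissible lines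
    ((∃ c : ℝ, SeparatesPoles k 0 (upperParams n l β) (lowerParams k) c) ∧
      ∀ c : ℝ, SeparatesPoles k 0 (upperParams n l β) (lowerParams k) c →
        Complex.VerticalIntegrable (meijerKernel k 0 (upperParams n l β) (lowerParams k)) c ∧
        ∀ z : ℝ, 0 < z →
          mellinInv c (meijerKernel k 0 (upperParams n l β) (lowerParams k)) z =
            meijerG k 0 (upperParams n l β) (lowerParams k) z) ∧
    -- the Laplace transform representation
    (∀ x : ℝ,
      Summable (fun r : ℕ => (-x) ^ r / Real.Gamma (β + (l : ℝ) / k * r) ^ n) ∧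
      MeasureTheory.IntegrableOn
        (fun y : ℝ => (Real.exp (-(x * y)) : ℂ) * leRoyWeight n l k β y) (Set.Ioi 0) ∧
      (mittagLefflerLeRoy n ((l : ℝ) / k) β (-x) : ℂ) =
        ∫ y in Set.Ioi (0 : ℝ), (Real.exp (-(x * y)) : ℂ) * leRoyWeight n l k β y) ∧
    -- the power series, with infinite radius of convergence
    (FormalMultilinearSeries.ofScalars ℝ (leRoyCoeff n l k β)).radius = ⊤ ∧
    (∀ y : ℝ, 0 < y →
      HasSum (fun r : ℕ => ((leRoyCoeff n l k β r * y ^ r : ℝ) : ℂ)) (leRoyWeight n l k β y)) ∧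
    -- the exponential bound
    (∃ A a : ℝ, ∀ y : ℝ, 0 < y → ‖leRoyWeight n l k β y‖ ≤ A * Real.exp (a * y)) := by
  have hk0 : (0 : ℝ) < k := by exact_mod_cast hk
  have hn0 : (0 : ℝ) < n := by exact_mod_cast hn
  have hα : 0 < (l : ℝ) / k := by positivity
  have hnα : n * ((l : ℝ) / k) < 1 := by
    rw [lt_div_iff₀ hn0] at hlk
    linarith
  have hcoeff : leRoyCoeff n l k β = leRoyTaylor n ((l : ℝ) / k) (β - (l : ℝ) / k) := by
    ext r
    rw [leRoyCoeff, leRoyTaylor]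
    ring_nf
  have hweight : ∀ y ∈ Set.Ioi (0 : ℝ),
      leRoyWeight n l k β y = leRoyDensity n ((l : ℝ) / k) (β - (l : ℝ) / k) y :=
    fun y hy => leRoyWeight_eq_leRoyDensity hl hk hnα β hy
  -- The moments are expressed through b + α, which is β.
  have hb : ∀ r : ℕ, β - (l : ℝ) / k + (l : ℝ) / k + (l : ℝ) / k * r = β + (l : ℝ) / k * r :=
    fun r => by ring
  refine ⟨⟨⟨0, separatesPoles_zero n l hk β⟩, fun c hc =>
    ⟨verticalIntegrable_meijerKernel hl hk hnα β hc,
      fun z hz => mellinInv_meijerKernel_eq_meijerG hl hk hnα β hc hz⟩⟩, fun x => ?_, ?_, ?_, ?_⟩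
  · obtain ⟨h1, h2⟩ := integrableOn_and_integral_exp_mul_leRoyDensity hn hα hnα
      (β - (l : ℝ) / k) x
    refine ⟨Real.summable_pow_div_Gamma_pow hn hα β (-x), h1.congr_fun (fun y hy => ?_)
      measurableSet_Ioi, ?_⟩
    · simp only
      rw [hweight y hy]
    · simp_rw [hb] at h2
      rw [mittagLefflerLeRoy, h2]
      refine MeasureTheory.setIntegral_congr_fun measurableSet_Ioi fun y hy => ?_
      rw [hweight y hy]
  · refine FormalMultilinearSeries.radius_eq_top_of_summable_norm _ fun r => ?_
    simp_rw [FormalMultilinearSeries.ofScalars_norm, hcoeff]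
    exact summable_leRoyTaylor hα hnα _ _
  · intro y hy
    rw [hweight y hy, hcoeff]
    exact hasSum_mellinInv_leRoyMellin hα hnα _ hy one_pos
  · obtain ⟨C, hC⟩ := exists_norm_leRoyDensity_le hn hα hnα (β - (l : ℝ) / k) le_rfl
    -- Decay at rate X = 0 is enough: the weight is bounded. The exponent is written -0 to match -(0
    -- * y).
    refine ⟨C, -0, fun y hy => ?_⟩
    rw [hweight y hy, neg_mul]
    exact hC y hy
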